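/- Let $1\le p<\infty$, $\beta\in\mathbb R$ with $\beta\neq p$, and let $C_D, C_H\ge 0$ be constants. Then there is $\varepsilon>0$, depending only on $p,\beta,C_D,C_H$, such that the following holds. Let $X=(X,d,\mu)$ be a complete metric space with a Borel measure $\mu$ such that all closed balls $B(x,r)=\{y: d(x,y)\le r\}$, $r>0$, satisfy $0<\mu(B(x,r))<\infty$ and $\mu(B(x,2r))\le C_D\,\mu(B(x,r))$. Let $\Omega\subset X$ be an open set, with complement $\Omega^c=X\setminus\Omega$ and $d_\Omega(x)=\operatorname{dist}(x,\Omega^c)$, that admits a $(p,\beta)$-Hardy inequality with constant $C_H$, that is, $$\int_\Omega |u|^p\, d_\Omega^{\beta-p}\,d\mu\le C_H\int_\Omega g^p\, d_\Omega^{\beta}\,d\mu$$ for all Lipschitz functions $u$ with compact support in $\Omega$ and all upper gradients $g$ of $u$ (Borel functions $g\colon X\to[0,\infty]$ with $|u(y)-u(x)|\le\int_\gamma g\,ds$ for every compact rectifiable curve $\gamma$ with endpoints $x,y$). Then for every ball $B_0=B(x_0,R_0)$, with $2B_0=B(x_0,2R_0)$, either $$\operatorname{co\,dim}_H(2B_0\cap\Omega^c)<p-\beta-\varepsilon\quad\text{or}\quad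 \underline{\operatorname{co\,dim}}_A(B_0\cap\Omega^c)>p-\beta+\varepsilon .$$ Here, for $E\subset X$, both codimensions take values in $[0,\infty]$ (suprema over $q,t\ge0$, the supremum of the empty set being $0$): * $\operatorname{co\,dim}_H(E)=\sup\{q\ge 0: \mathcal H^{\mu,q}_R(E)=0 \text{ for all } 0<R<\infty\}$, where $\mathcal H^{\mu,q}_R(E)$ is the infimum of $\sum_k \operatorname{rad}(B_k)^{-q}\mu(B_k)$ over all countable covers of $E$ by balls $B_k$ of radius at most $R$. * $\underline{\operatorname{co\,dim}}_A(E)$ is the supremum of all $t\ge0$ for which there is $C\ge1$ such that $\mu(E_r\cap B(x,R))/\mu(B(x,R))\le C(r/R)^t$ for all $x\in E$ and all $0<r<R<\operatorname{diam}(E)$, where $E_r=\{y:\operatorname{dist}(y,E)<r\}$; if $E$ is a single point, the range of radii is $0<r<R\le1$ instead. -/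

import Mathlib

open MeasureTheory Metric Set
open scoped NNReal ENNReal

/-- `μ` gives every (closed) ball of positive radius positive finite measure, and it is doubling with
constant `C`. -/
structure IsDoublingWith {X : Type*} [MetricSpace X] [MeasurableSpace X]
    (μ : Measure X) (C : ℝ≥0) : Prop where
  measure_pos : ∀ (x : X) (r : ℝ), 0 < r → 0 < μ (closedBall x r)
  measure_lt_top : ∀ (x : X) (r : ℝ), 0 < r → μ (closedBall x r) < ∞
  doubling : ∀ (x : X) (r : ℝ), 0 < r → μ (closedBall x (2 * r)) ≤ C * μ (closedBall x r)

/-- `g : X → [0,∞]` is an upper gradient of `f : X → ℝ`: it is Borel, and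
`|f y - f x| ≤ ∫_γ g ds` for every compact rectifiable curve `γ` with endpoints `x`, `y`.
The integral `∫_γ g ds` is by definition the integral of `g` along the arc-length parametrization
of `γ`, and each compact rectifiable curve has one (with the same endpoints); so the
curves are taken parametrized by arc length, on an arbitrary compact interval `[a, b]`. -/
def IsUpperGradient {X : Type*} [MetricSpace X] [MeasurableSpace X]
    (g : X → ℝ≥0∞) (f : X → ℝ) : Prop :=
  Measurable g ∧
    ∀ (γ : ℝ → X) (a b : ℝ), a ≤ b → HasUnitSpeedOn γ (Icc a b) →
      ENNReal.ofReal |f (γ b) - f (γ a)| ≤ ∫⁻ t in Icc a b, g (γ t)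

/-- `Ω` admits a `(p, β)`-Hardy inequality with constant `C`. The test functions, Lipschitz with
compact support in `Ω`, are extended by zero to `X`; `infDist x Ωᶜ` is the distance to the
complement. -/
def AdmitsHardyWith {X : Type*} [MetricSpace X] [MeasurableSpace X]
    (μ : Measure X) (Ω : Set X) (p β : ℝ) (C : ℝ≥0) : Prop :=
  ∀ u : X → ℝ, (∃ L : ℝ≥0, LipschitzWith L u) → HasCompactSupport u → tsupport u ⊆ Ω →
    ∀ g : X → ℝ≥0∞, IsUpperGradient g u →
      ∫⁻ x in Ω, ENNReal.ofReal (|u x| ^ p * infDist x Ωᶜ ^ (β - p)) ∂μ ≤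
        C * ∫⁻ x in Ω, g x ^ p * ENNReal.ofReal (infDist x Ωᶜ ^ β) ∂μ

/-- The Hausdorff content of codimension `q` at scale `R`: the infimum of
`∑ rad(B)^{-q} μ(B)` over countable (possibly finite or empty) covers of `E` by balls of radius
at most `R`. A ball is given by its centre and its radius. -/
noncomputable def hausdorffCocontent {X : Type*} [MetricSpace X] [MeasurableSpace X]
    (μ : Measure X) (R q : ℝ) (E : Set X) : ℝ≥0∞ :=
  ⨅ (F : Set (X × ℝ)) (_ : F.Countable) (_ : ∀ b ∈ F, 0 < b.2 ∧ b.2 ≤ R)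
    (_ : E ⊆ ⋃ b ∈ F, closedBall b.1 b.2),
    ∑' b : F, ENNReal.ofReal (b.1.2 ^ (-q)) * μ (closedBall b.1.1 b.1.2)

/-- The Hausdorff codimension, with values in `[0,∞]`: the supremum of the `q ≥ 0` such that the
content of codimension `q` vanishes. For a doubling measure the vanishing at one scale
`0 < R < ∞` is equivalent to the vanishing at all of them. If `μ E > 0` then
no `q ≥ 0` qualifies and the value is `0`. -/
noncomputable def codimH {X : Type*} [MetricSpace X] [MeasurableSpace X]
    (μ : Measure X) (E : Set X) : ℝ≥0∞ :=
  ⨆ (q : ℝ≥0) (_ : ∀ R : ℝ, 0 < R → hausdorffCocontent μ R q E = 0), (q : ℝ≥0∞)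

/-- The lower Assouad codimension, with values in `[0,∞]`: the supremum of the `t ≥ 0` such that,
for some `C ≥ 1`, `μ(E_r ∩ B(x,R)) / μ(B(x,R)) ≤ C (r/R)^t` for all `x ∈ E` and
`0 < r < R < diam E`. If `E` is a single point that range is empty, and the radii
`0 < r < R ≤ 1` are used. Here `E_r` is the open `r`-neighbourhood. -/
noncomputable def lcodimA {X : Type*} [MetricSpace X] [MeasurableSpace X]
    (μ : Measure X) (E : Set X) : ℝ≥0∞ :=
  ⨆ (t : ℝ≥0) (_ : ∃ C : ℝ, 1 ≤ C ∧ ∀ x ∈ E, ∀ r R : ℝ, 0 < r → r < R →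
      (ENNReal.ofReal R < ediam E ∨ (E.Subsingleton ∧ R ≤ 1)) →
      μ (thickening r E ∩ closedBall x R) / μ (closedBall x R) ≤
        ENNReal.ofReal (C * (r / R) ^ (t : ℝ))), (t : ℝ≥0∞)

/-!
Let `d` be the distance to `Ωᶜ` and test the Hardy inequality with `θ ^ (n + 1) * w(d)`, where
`w(s) = (s ^ δ + a ^ (2 * δ) * s ^ (-δ))⁻¹` and `θ` is a cutoff function. Since
`|w'(s)| ≤ δ * w(s) / s`, for small `δ` the term of the gradient that comes from `w` is absorbed by
the left-hand side, and only the slopes of `θ` remain.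

If the Hausdorff codimension of `2B₀ ∩ Ωᶜ` exceeds `p - β - δ * p`, then `Ωᶜ` is covered, inside a
ball `B(c, 4r) ⊆ 2B₀` that meets it, by balls `B(z, ρ)` with an arbitrarily small sum of
`ρ ^ (-(p - β - δ * p)) * μ(B(z, ρ))`. As `w(ρ) ≤ a ^ (-2 * δ) * ρ ^ δ`, this makes it possible to
cut off on these balls at a negligible cost, so that the cutoff at the scale `r` dominates. As
`w(s)` is comparable to `s ^ (-δ)` for `s ≥ a`, the measure of `{a ≤ d < s}` in `B(c, 3r)` is at
most a multiple of `(s / r) ^ (p - β + δ * p) * μ(B(c, 4r))`, independently of `a`. Letting `a → 0`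
bounds the lower Assouad codimension of `B₀ ∩ Ωᶜ` from below by `p - β + δ * p`.
-/

open Filter Topology

section PointwiseLipschitz

variable {X Y Z : Type*} [PseudoMetricSpace X] [PseudoMetricSpace Y] [PseudoMetricSpace Z]
  {f : X → Y} {g : Y → Z} {a b c : ℝ} {x : X}

/-- The pointwise Lipschitz constant `limsup_{y → x} d(f y, f x) / d(y, x)` is at most `c`. The
quotients are cleared of their denominators, so that nothing is required at an isolated point. -/
def HasLipBoundAt (c : ℝ) (f : X → Y) (x : X) : Prop :=
  ∀ c' > c, ∀ᶠ y in 𝓝 x, dist (f y) (f x) ≤ c' * dist y x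

namespace HasLipBoundAt

theorem mono (hf : HasLipBoundAt a f x) (hab : a ≤ b) : HasLipBoundAt b f x :=
  fun c' hc' => hf c' (hab.trans_lt hc')

theorem of_lipschitzWith {K : ℝ≥0} (hf : LipschitzWith K f) (x : X) : HasLipBoundAt K f x :=
  fun _ hc' => Eventually.of_forall fun y =>
    (hf.dist_le_mul y x).trans (mul_le_mul_of_nonneg_right hc'.le dist_nonneg)

theorem of_eventually_eq (hf : ∀ᶠ y in 𝓝 x, f y = f x) : HasLipBoundAt 0 f x := fun c' hc' => by
  filter_upwards [hf] with y hy
  rw [hy, dist_self]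
  exact mul_nonneg (le_of_lt hc') dist_nonneg

theorem of_hasDerivAt {φ : ℝ → ℝ} {e s : ℝ} (h : HasDerivAt φ e s) : HasLipBoundAt |e| φ s := by
  intro c' hc'
  filter_upwards [(hasDerivAt_iff_isLittleO.1 h).bound (sub_pos.2 hc')] with y hy
  simp only [smul_eq_mul, Real.norm_eq_abs] at hy
  rw [Real.dist_eq, Real.dist_eq]
  calc |φ y - φ s| = |(φ y - φ s - (y - s) * e) + (y - s) * e| := by rw [sub_add_cancel]
    _ ≤ (c' - |e|) * |y - s| + |y - s| * |e| :=
        (abs_add_le _ _).trans (add_le_add hy (abs_mul _ _).le)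
    _ = c' * |y - s| := by ring

theorem continuousAt (hf : HasLipBoundAt c f x) : ContinuousAt f x := by
  refine tendsto_iff_dist_tendsto_zero.2 (squeeze_zero' (Eventually.of_forall fun _ => dist_nonneg)
    (hf (c + 1) (lt_add_one c)) ?_)
  simpa using (tendsto_iff_dist_tendsto_zero.1 (tendsto_id (x := 𝓝 x))).const_mul (c + 1)

theorem comp (hg : HasLipBoundAt b g (f x)) (hf : HasLipBoundAt a f x) (hb : 0 ≤ b) :
    HasLipBoundAt (b * a) (g ∘ f) x := by
  intro c' hc'
  have hlim : Tendsto (fun t : ℝ => (b + t) * (a + t)) (𝓝[>] 0) (𝓝 (b * a)) := by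
    refine (Continuous.tendsto' ?_ _ _ (by simp)).mono_left nhdsWithin_le_nhds
    fun_prop
  obtain ⟨t, htc, ht⟩ := ((hlim.eventually_lt_const hc').and self_mem_nhdsWithin).exists
  filter_upwards [hf.continuousAt.eventually (hg (b + t) (by linarith)),
    hf (a + t) (by linarith)] with y hgy hfy
  calc dist (g (f y)) (g (f x)) ≤ (b + t) * dist (f y) (f x) := hgy
    _ ≤ (b + t) * ((a + t) * dist y x) := by gcongr
    _ ≤ c' * dist y x := by rw [← mul_assoc]; gcongr

theorem mul {u v : X → ℝ} (hu : HasLipBoundAt a u x) (hv : HasLipBoundAt b v x) :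
    HasLipBoundAt (a * |v x| + |u x| * b) (fun y => u y * v y) x := by
  intro c' hc'
  have hlim : Tendsto (fun t : ℝ => (a + t) * |v x| + (|u x| + t) * (b + t)) (𝓝[>] 0)
      (𝓝 (a * |v x| + |u x| * b)) := by
    refine (Continuous.tendsto' ?_ _ _ (by simp)).mono_left nhdsWithin_le_nhds
    fun_prop
  obtain ⟨t, htc, ht⟩ := ((hlim.eventually_lt_const hc').and self_mem_nhdsWithin).exists
  filter_upwards [hu (a + t) (by linarith), hv (b + t) (by linarith),
    hu.continuousAt.abs.eventually_le_const (lt_add_of_pos_right |u x| ht)] with y huy hvy huy'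
  rw [Real.dist_eq] at huy hvy ⊢
  calc |u y * v y - u x * v x| = |(u y - u x) * v x + u y * (v y - v x)| := by ring_nf
    _ ≤ |u y - u x| * |v x| + |u y| * |v y - v x| := by
        rw [← abs_mul, ← abs_mul]; exact abs_add_le _ _
    _ ≤ (a + t) * dist y x * |v x| + (|u x| + t) * ((b + t) * dist y x) := by gcongr
    _ = ((a + t) * |v x| + (|u x| + t) * (b + t)) * dist y x := by ring
    _ ≤ c' * dist y x := by gcongr

theorem pow_succ {u : X → ℝ} (hu : HasLipBoundAt a u x) (n : ℕ) :
    HasLipBoundAt ((n + 1) * |u x| ^ n * a) (fun y => u y ^ (n + 1)) x := by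
  have hpow := (of_hasDerivAt (hasDerivAt_pow (n + 1) (u x))).comp hu (abs_nonneg _)
  rwa [abs_mul, abs_pow, Nat.abs_cast, Nat.add_sub_cancel, Nat.cast_succ] at hpow

theorem inf' {ι : Type*} {s : Finset ι} (hs : s.Nonempty) {f : ι → X → ℝ}
    (hf : ∀ i ∈ s, HasLipBoundAt c (f i) x) :
    HasLipBoundAt c (fun y => s.inf' hs fun i => f i y) x := by
  intro c' hc'
  filter_upwards [(Finset.eventually_all s).2 fun i hi => hf i hi c' hc'] with y hy
  simp only [Real.dist_eq, abs_le, sub_le_iff_le_add] at hy ⊢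
  obtain ⟨i, hi, hiy⟩ := s.exists_mem_eq_inf' hs fun i => f i y
  obtain ⟨j, hj, hjx⟩ := s.exists_mem_eq_inf' hs fun i => f i x
  constructor
  · linarith [(hy i hi).1, s.inf'_le (fun i => f i x) hi]
  · linarith [(hy j hj).2, s.inf'_le (fun i => f i y) hj]

theorem abs_deriv_comp_le {u : X → ℝ} {γ : ℝ → X} {t : ℝ} (hu : HasLipBoundAt c u (γ t))
    (hc : 0 ≤ c) (hγ : LipschitzWith 1 γ) : |deriv (u ∘ γ) t| ≤ c := by
  refine le_of_forall_gt_imp_ge_of_dense fun c' hc' => ?_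
  have hcomp : HasLipBoundAt (c * 1) (u ∘ γ) t := hu.comp (of_lipschitzWith hγ t) hc
  rw [mul_one] at hcomp
  exact norm_deriv_le_of_lip' (hc.trans hc'.le) (by simpa only [dist_eq_norm] using hcomp c' hc')

end HasLipBoundAt

end PointwiseLipschitz

section UpperGradient

theorem lipschitzOnWith_of_hasConstantSpeedOnWith {Y : Type*} [PseudoEMetricSpace Y] {γ : ℝ → Y}
    {s : Set ℝ} {l : ℝ≥0} (h : HasConstantSpeedOnWith γ s l) : LipschitzOnWith l γ s := by
  have h_of_le : ∀ x ∈ s, ∀ y ∈ s, x ≤ y → edist (γ x) (γ y) ≤ l * edist x y := by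
    intro x hx y hy hxy
    calc edist (γ x) (γ y) ≤ eVariationOn γ (s ∩ Icc x y) :=
          eVariationOn.edist_le γ ⟨hx, left_mem_Icc.2 hxy⟩ ⟨hy, right_mem_Icc.2 hxy⟩
      _ = l * edist x y := by
          rw [h hx hy, ENNReal.ofReal_mul l.coe_nonneg, ENNReal.ofReal_coe_nnreal, edist_comm,
            edist_dist, Real.dist_eq, abs_of_nonneg (sub_nonneg.2 hxy)]
  intro x hx y hy
  rcases le_total x y with hxy | hxy
  · exact h_of_le x hx y hy hxy
  · rw [edist_comm (γ x), edist_comm x]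
    exact h_of_le y hy x hx hxy

theorem isUpperGradient_of_hasLipBoundAt {X : Type*} [MetricSpace X] [MeasurableSpace X]
    {G u : X → ℝ} (hG : Measurable G) (hG0 : ∀ x, 0 ≤ G x) {L : ℝ≥0} (hu : LipschitzWith L u)
    (h : ∀ x, HasLipBoundAt (G x) u x) : IsUpperGradient (fun x => ENNReal.ofReal (G x)) u := by
  refine ⟨hG.ennreal_ofReal, fun γ a b hab hγ => ?_⟩
  set γ' : ℝ → X := IccExtend hab ((Icc a b).domRestrict γ)
  have hγ' : LipschitzWith 1 γ' := by
    have hrestrict := (lipschitzOnWith_of_hasConstantSpeedOnWith hγ).to_restrict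
    simpa only [mul_one] using! hrestrict.comp (LipschitzWith.projIcc hab)
  have heq : ∀ t ∈ Icc a b, γ' t = γ t := fun t ht => IccExtend_of_mem _ _ ht
  have hac : AbsolutelyContinuousOnInterval (u ∘ γ') a b :=
    ((hu.comp hγ').lipschitzOnWith (s := uIcc a b)).absolutelyContinuousOnInterval
  have hftc : u (γ b) - u (γ a) = ∫ t in Ioc a b, deriv (u ∘ γ') t := by
    rw [← intervalIntegral.integral_of_le hab, hac.integral_deriv_eq_sub, Function.comp_apply,
      Function.comp_apply, heq a (left_mem_Icc.2 hab), heq b (right_mem_Icc.2 hab)]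
  calc ENNReal.ofReal |u (γ b) - u (γ a)| = ‖∫ t in Ioc a b, deriv (u ∘ γ') t‖ₑ := by
        rw [hftc, Real.enorm_eq_ofReal_abs]
    _ ≤ ∫⁻ t in Ioc a b, ‖deriv (u ∘ γ') t‖ₑ := enorm_integral_le_lintegral_enorm _
    _ ≤ ∫⁻ t in Icc a b, ‖deriv (u ∘ γ') t‖ₑ := lintegral_mono_set Ioc_subset_Icc_self
    _ ≤ ∫⁻ t in Icc a b, ENNReal.ofReal (G (γ t)) := by
        refine setLIntegral_mono' measurableSet_Icc fun t ht => ?_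
        rw [Real.enorm_eq_ofReal_abs, ← heq t ht]
        exact ENNReal.ofReal_le_ofReal ((h _).abs_deriv_comp_le (hG0 _) hγ')

end UpperGradient

section Peak

theorem rpow_le_rpow_abs_mul_rpow {κ s t : ℝ} (hs : 0 < s) (ht : 0 < t) (hst : s ≤ κ * t)
    (hts : t ≤ κ * s) (b : ℝ) : s ^ b ≤ κ ^ |b| * t ^ b := by
  have hκ : 0 < κ := pos_of_mul_pos_left (hs.trans_le hst) ht.le
  rcases le_total 0 b with hb | hb
  · rw [abs_of_nonneg hb, ← Real.mul_rpow hκ.le ht.le]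
    exact Real.rpow_le_rpow hs.le hst hb
  · calc s ^ b = κ ^ |b| * (κ * s) ^ b := by
          rw [abs_of_nonpos hb, Real.mul_rpow hκ.le hs.le, ← mul_assoc, ← Real.rpow_add hκ,
            neg_add_cancel, Real.rpow_zero, one_mul]
      _ ≤ κ ^ |b| * t ^ b := by
          gcongr κ ^ |b| * ?_
          exact Real.rpow_le_rpow_of_nonpos ht hts hb

/-- The profile `s ↦ (s ^ δ + a ^ (2 * δ) * s ^ (-δ))⁻¹` of the test functions: a multiple of
`s ^ δ` for `s ≪ a` that turns into `s ^ (-δ)` at the scale `s = a`. -/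
noncomputable def peak (δ a s : ℝ) : ℝ := (s ^ δ + a ^ (2 * δ) * s ^ (-δ))⁻¹

variable {δ a s : ℝ}

theorem peak_pos (ha : 0 < a) (hs : 0 < s) : 0 < peak δ a s := by
  unfold peak; positivity

theorem peak_nonneg (ha : 0 < a) (hs : 0 ≤ s) : 0 ≤ peak δ a s := by
  unfold peak; positivity

theorem peak_le_rpow_neg (ha : 0 < a) (hs : 0 < s) : peak δ a s ≤ s ^ (-δ) := by
  rw [peak, Real.rpow_neg hs.le δ]
  exact inv_anti₀ (by positivity) (le_add_of_nonneg_right (by positivity))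

theorem peak_le_mul_rpow (ha : 0 < a) (hs : 0 < s) : peak δ a s ≤ a ^ (-2 * δ) * s ^ δ := by
  calc peak δ a s ≤ (a ^ (2 * δ) * s ^ (-δ))⁻¹ :=
        inv_anti₀ (by positivity) (le_add_of_nonneg_left (by positivity))
    _ = a ^ (-2 * δ) * s ^ δ := by
        rw [mul_inv, ← Real.rpow_neg ha.le, ← Real.rpow_neg hs.le, neg_neg, neg_mul]

theorem rpow_neg_div_two_le_peak (hδ : 0 ≤ δ) (ha : 0 < a) (has : a ≤ s) :
    s ^ (-δ) / 2 ≤ peak δ a s := by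
  have hs : 0 < s := ha.trans_le has
  have htail : a ^ (2 * δ) * s ^ (-δ) ≤ s ^ δ := by
    calc a ^ (2 * δ) * s ^ (-δ) ≤ s ^ (2 * δ) * s ^ (-δ) := by gcongr
      _ = s ^ δ := by rw [← Real.rpow_add hs]; ring_nf
  calc s ^ (-δ) / 2 = (s ^ δ + s ^ δ)⁻¹ := by
        rw [Real.rpow_neg hs.le, ← two_mul, mul_inv, div_eq_inv_mul]
    _ ≤ peak δ a s := inv_anti₀ (by positivity) (by gcongr)

theorem peak_le_rpow_mul_peak {κ t : ℝ} (hδ : 0 ≤ δ) (ha : 0 < a) (hs : 0 < s) (ht : 0 < t)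
    (hst : s ≤ κ * t) (hts : t ≤ κ * s) : peak δ a s ≤ κ ^ δ * peak δ a t := by
  have h_pos : t ^ δ ≤ κ ^ δ * s ^ δ := by
    simpa only [abs_of_nonneg hδ] using rpow_le_rpow_abs_mul_rpow ht hs hts hst δ
  have h_neg : t ^ (-δ) ≤ κ ^ δ * s ^ (-δ) := by
    simpa only [abs_neg, abs_of_nonneg hδ] using rpow_le_rpow_abs_mul_rpow ht hs hts hst (-δ)
  rw [peak, peak, ← div_eq_mul_inv, le_div_iff₀ (by positivity), inv_mul_le_iff₀ (by positivity)]
  calc t ^ δ + a ^ (2 * δ) * t ^ (-δ)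
      ≤ κ ^ δ * s ^ δ + a ^ (2 * δ) * (κ ^ δ * s ^ (-δ)) := by gcongr
    _ = (s ^ δ + a ^ (2 * δ) * s ^ (-δ)) * κ ^ δ := by ring

theorem exists_hasDerivAt_peak (hδ : 0 ≤ δ) (ha : 0 < a) (hs : 0 < s) :
    ∃ e, HasDerivAt (peak δ a) e s ∧ |e| ≤ δ * peak δ a s / s := by
  set D : ℝ := s ^ δ + a ^ (2 * δ) * s ^ (-δ) with hD
  have hD0 : 0 < D := by positivity
  have hderiv : HasDerivAt (fun s : ℝ => s ^ δ + a ^ (2 * δ) * s ^ (-δ))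
      (δ / s * (s ^ δ - a ^ (2 * δ) * s ^ (-δ))) s := by
    refine ((Real.hasDerivAt_rpow_const (p := δ) (Or.inl hs.ne')).add
      ((Real.hasDerivAt_rpow_const (p := -δ) (Or.inl hs.ne')).const_mul _)).congr_deriv ?_
    rw [Real.rpow_sub_one hs.ne', Real.rpow_sub_one hs.ne']
    ring
  refine ⟨_, hderiv.fun_inv hD0.ne', ?_⟩
  have habs : |s ^ δ - a ^ (2 * δ) * s ^ (-δ)| ≤ D := by
    have : 0 ≤ s ^ δ := by positivity
    have : 0 ≤ a ^ (2 * δ) * s ^ (-δ) := by positivity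
    exact abs_le.2 ⟨by linarith, by linarith⟩
  rw [abs_div, abs_neg, abs_mul, abs_of_nonneg (div_nonneg hδ hs.le), ← hD,
    abs_of_pos (pow_pos hD0 2)]
  calc δ / s * |s ^ δ - a ^ (2 * δ) * s ^ (-δ)| / D ^ 2 ≤ δ / s * D / D ^ 2 := by gcongr
    _ = δ * peak δ a s / s := by rw [peak, ← hD]; field_simp

theorem hasLipBoundAt_peak (hδ : 0 ≤ δ) (ha : 0 < a) (hs : 0 < s) :
    HasLipBoundAt (δ * peak δ a s / s) (peak δ a) s := by
  obtain ⟨e, he, hle⟩ := exists_hasDerivAt_peak hδ ha hs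
  exact (HasLipBoundAt.of_hasDerivAt he).mono hle

theorem measurable_peak : Measurable (peak δ a) := by
  unfold peak; fun_prop

theorem exists_lipschitzOnWith_peak (hδ : 0 ≤ δ) (ha : 0 < a) {b : ℝ} (hb : 0 < b) :
    ∃ K, LipschitzOnWith K (peak δ a) (Ici b) := by
  have hpos : ∀ s ∈ Ici b, 0 < s := fun s hs => hb.trans_le hs
  refine ⟨(δ * b ^ (-δ) / b).toNNReal, (convex_Ici b).lipschitzOnWith_of_nnnorm_deriv_le
    (fun s hs => ?_) (fun s hs => ?_)⟩ <;>
    obtain ⟨e, he, hle⟩ := exists_hasDerivAt_peak hδ ha (hpos s hs)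
  · exact he.differentiableAt
  · rw [he.deriv, ← NNReal.coe_le_coe, coe_nnnorm, Real.norm_eq_abs]
    refine (hle.trans ?_).trans (Real.le_coe_toNNReal _)
    have hbs : b ≤ s := hs
    have hpeak : peak δ a s ≤ b ^ (-δ) := (peak_le_rpow_neg ha (hpos s hs)).trans
      (Real.rpow_le_rpow_of_nonpos hb hbs (neg_nonpos.2 hδ))
    gcongr

end Peak

section TestFunction

theorem lipschitzWith_mul_of_abs_le {X : Type*} [PseudoMetricSpace X] {f g : X → ℝ} {K L A B : ℝ≥0}
    (hf : LipschitzWith K f) (hg : LipschitzWith L g) (hA : ∀ x, |f x| ≤ A) (hB : ∀ x, |g x| ≤ B) :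
    LipschitzWith (K * B + A * L) (fun x => f x * g x) := by
  refine LipschitzWith.of_dist_le_mul fun x y => ?_
  have hfxy := hf.dist_le_mul x y
  have hgxy := hg.dist_le_mul x y
  rw [Real.dist_eq] at hfxy hgxy ⊢
  calc |f x * g x - f y * g y| = |(f x - f y) * g x + f y * (g x - g y)| := by ring_nf
    _ ≤ |f x - f y| * |g x| + |f y| * |g x - g y| := by
        rw [← abs_mul, ← abs_mul]; exact abs_add_le _ _
    _ ≤ K * dist x y * B + A * (L * dist x y) := by gcongr <;> apply_assumption
    _ = (K * B + A * L : ℝ≥0) * dist x y := by push_cast; ring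

theorem exists_lipschitzWith_pow_of_abs_le_one {X : Type*} [PseudoMetricSpace X] {f : X → ℝ}
    {K : ℝ≥0} (hf : LipschitzWith K f) (hf1 : ∀ x, |f x| ≤ 1) (n : ℕ) :
    ∃ L, LipschitzWith L (fun x => f x ^ n) := by
  induction n with
  | zero => exact ⟨0, by simpa only [pow_zero] using LipschitzWith.const 1⟩
  | succ n ih =>
    obtain ⟨L, hL⟩ := ih
    simp only [pow_succ]
    exact ⟨_, lipschitzWith_mul_of_abs_le hL hf (A := 1) (B := 1)
      (fun x => by simpa only [abs_pow, NNReal.coe_one] using pow_le_one₀ (abs_nonneg _) (hf1 x))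
      hf1⟩

theorem infDist_compl_pos {X : Type*} [PseudoMetricSpace X] {Ω : Set X} (hΩ : IsOpen Ω)
    (hne : Ωᶜ.Nonempty) {x : X} (hx : x ∈ Ω) : 0 < infDist x Ωᶜ :=
  (hΩ.isClosed_compl.notMem_iff_infDist_pos hne).1 (notMem_compl_iff.2 hx)

variable {X : Type*} [MetricSpace X] {Ω : Set X} {δ a : ℝ} {θ : X → ℝ} {L : ℝ≥0}

theorem exists_lipschitzWith_pow_mul_peak_infDist (hΩ : IsOpen Ω) (hne : Ωᶜ.Nonempty)
    (hδ : 0 ≤ δ) (ha : 0 < a) (hθL : LipschitzWith L θ) (hθ1 : ∀ x, |θ x| ≤ 1)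
    (hθc : HasCompactSupport θ) (hθΩ : tsupport θ ⊆ Ω) (n : ℕ) :
    ∃ K, LipschitzWith K fun x => θ x ^ (n + 1) * peak δ a (infDist x Ωᶜ) := by
  obtain ⟨b, hb, hbd⟩ : ∃ b > 0, ∀ x ∈ tsupport θ, b ≤ infDist x Ωᶜ :=
    hθc.isCompact.exists_forall_le' (continuous_infDist_pt Ωᶜ).continuousOn
      fun x hx => infDist_compl_pos hΩ hne (hθΩ hx)
  obtain ⟨K, hK⟩ := exists_lipschitzWith_pow_of_abs_le_one hθL hθ1 (n + 1)
  obtain ⟨M, hM⟩ := exists_lipschitzOnWith_peak hδ ha hb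
  have hpeakL : LipschitzWith (M * 1) fun x => peak δ a (max (infDist x Ωᶜ) b) :=
    lipschitzOnWith_univ.1 <| hM.comp ((lipschitz_infDist_pt Ωᶜ).max_const b).lipschitzOnWith
      fun x _ => mem_Ici.2 (le_max_right _ _)
  have hpeak_le : ∀ x, |peak δ a (max (infDist x Ωᶜ) b)| ≤ (b ^ (-δ)).toNNReal := fun x => by
    have hpos : 0 < max (infDist x Ωᶜ) b := lt_max_of_lt_right hb
    rw [abs_of_pos (peak_pos ha hpos), Real.coe_toNNReal _ (by positivity)]
    exact (peak_le_rpow_neg ha hpos).trans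
      (Real.rpow_le_rpow_of_nonpos hb (le_max_right _ _) (neg_nonpos.2 hδ))
  have heq : (fun x => θ x ^ (n + 1) * peak δ a (infDist x Ωᶜ)) =
      fun x => θ x ^ (n + 1) * peak δ a (max (infDist x Ωᶜ) b) := by
    funext x
    by_cases hx : x ∈ tsupport θ
    · rw [max_eq_left (hbd x hx)]
    · rw [image_eq_zero_of_notMem_tsupport hx, zero_pow n.succ_ne_zero, zero_mul, zero_mul]
  rw [heq]
  exact ⟨_, lipschitzWith_mul_of_abs_le hK hpeakL (A := 1)
    (fun x => by simpa only [abs_pow, NNReal.coe_one] using pow_le_one₀ (abs_nonneg _) (hθ1 x))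
    hpeak_le⟩

theorem hasLipBoundAt_pow_mul_peak_infDist {x : X} {c : ℝ} (hδ : 0 ≤ δ) (ha : 0 < a)
    (hx : 0 < infDist x Ωᶜ) (hθ0 : 0 ≤ θ x) (hθ : HasLipBoundAt c θ x) (n : ℕ) :
    HasLipBoundAt (θ x ^ (n + 1) * (δ * peak δ a (infDist x Ωᶜ) / infDist x Ωᶜ) +
      (n + 1) * (θ x ^ n * peak δ a (infDist x Ωᶜ) * c))
      (fun y => θ y ^ (n + 1) * peak δ a (infDist y Ωᶜ)) x := by
  have hpeak0 : 0 ≤ peak δ a (infDist x Ωᶜ) := peak_nonneg ha hx.le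
  have hpeak : HasLipBoundAt (δ * peak δ a (infDist x Ωᶜ) / infDist x Ωᶜ * (1 : ℝ≥0))
      (fun y => peak δ a (infDist y Ωᶜ)) x :=
    HasLipBoundAt.comp (f := fun y => infDist y Ωᶜ) (hasLipBoundAt_peak hδ ha hx)
      (.of_lipschitzWith (lipschitz_infDist_pt Ωᶜ) x) (by positivity)
  refine ((hθ.pow_succ n).mul hpeak).mono (le_of_eq ?_)
  rw [abs_of_nonneg hpeak0, abs_pow, abs_of_nonneg hθ0, NNReal.coe_one]
  ring

theorem isUpperGradient_pow_mul_peak_infDist [MeasurableSpace X] [BorelSpace X] {G : X → ℝ}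
    (hΩ : IsOpen Ω) (hne : Ωᶜ.Nonempty) (hδ : 0 ≤ δ) (ha : 0 < a) (hθL : LipschitzWith L θ)
    (hθ01 : ∀ x, θ x ∈ Icc 0 1) (hθc : HasCompactSupport θ) (hθΩ : tsupport θ ⊆ Ω)
    (hGm : Measurable G) (hG0 : ∀ x, 0 ≤ G x) (hG : ∀ x, HasLipBoundAt (G x) θ x) (n : ℕ) :
    IsUpperGradient
      (fun x => ENNReal.ofReal (θ x ^ (n + 1) * (δ * peak δ a (infDist x Ωᶜ) / infDist x Ωᶜ) +
        (n + 1) * (θ x ^ n * peak δ a (infDist x Ωᶜ) * G x)))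
      (fun x => θ x ^ (n + 1) * peak δ a (infDist x Ωᶜ)) := by
  obtain ⟨K, hK⟩ := exists_lipschitzWith_pow_mul_peak_infDist hΩ hne hδ ha hθL
    (fun x => abs_le.2 ⟨by linarith [(hθ01 x).1], (hθ01 x).2⟩) hθc hθΩ n
  have hθm : Measurable θ := hθL.continuous.measurable
  have hdm : Measurable fun x => infDist x Ωᶜ := (continuous_infDist_pt _).measurable
  have hpm : Measurable fun x => peak δ a (infDist x Ωᶜ) := measurable_peak.comp hdm
  have hgrad0 : ∀ x, 0 ≤ θ x ^ (n + 1) * (δ * peak δ a (infDist x Ωᶜ) / infDist x Ωᶜ) +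
      (n + 1) * (θ x ^ n * peak δ a (infDist x Ωᶜ) * G x) := fun x => by
    have := (hθ01 x).1
    have := hG0 x
    have : 0 ≤ infDist x Ωᶜ := infDist_nonneg
    have := peak_nonneg (δ := δ) ha this
    positivity
  refine isUpperGradient_of_hasLipBoundAt (by fun_prop) hgrad0 hK fun x => ?_
  by_cases hx : x ∈ Ω
  · exact hasLipBoundAt_pow_mul_peak_infDist hδ ha (infDist_compl_pos hΩ hne hx) (hθ01 x).1 (hG x) n
  · have hθ0 : θ =ᶠ[𝓝 x] 0 := notMem_tsupport_iff_eventuallyEq.1 fun h => hx (hθΩ h)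
    refine (HasLipBoundAt.of_eventually_eq ?_).mono (hgrad0 x)
    filter_upwards [hθ0] with y hy
    simp only [hy, hθ0.self_of_nhds, Pi.zero_apply, zero_pow n.succ_ne_zero, zero_mul]

end TestFunction

section Absorption

theorem le_two_mul_of_le_half_mul_add {W B : ℝ≥0∞} (hW : W ≠ ∞) (h : W ≤ 2⁻¹ * W + B) :
    W ≤ 2 * B := by
  have hhalf : 2⁻¹ * W ≤ B := by
    refine (ENNReal.add_le_add_iff_left (ENNReal.mul_ne_top (by simp) hW)).1 (le_trans ?_ h)
    rw [← add_mul, ENNReal.inv_two_add_inv_two, one_mul]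
  calc W = 2 * (2⁻¹ * W) := by
        rw [← mul_assoc, ENNReal.mul_inv_cancel two_ne_zero ENNReal.ofNat_ne_top, one_mul]
    _ ≤ 2 * B := by gcongr

variable {X : Type*} [MetricSpace X] [MeasurableSpace X] [BorelSpace X] {μ : Measure X}
  [IsFiniteMeasureOnCompacts μ] {Ω : Set X} {p : ℝ} {u : X → ℝ}

theorem lintegral_abs_rpow_mul_infDist_rpow_lt_top (hΩ : IsOpen Ω) (hne : Ωᶜ.Nonempty)
    (hp : 0 < p) (hu : Continuous u) (huc : HasCompactSupport u) (huΩ : tsupport u ⊆ Ω) (b : ℝ) :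
    ∫⁻ x, ENNReal.ofReal (|u x| ^ p * infDist x Ωᶜ ^ b) ∂μ < ∞ := by
  set w : X → ℝ := fun x => |u x| ^ p * infDist x Ωᶜ ^ b with hw
  have hwu : Function.support w ⊆ Function.support u := fun x hx h0 => hx (by
    simp only [hw, h0, abs_zero, Real.zero_rpow hp.ne', zero_mul])
  have hcont : Continuous w := by
    refine ContinuousOn.continuous_of_tsupport_subset ?_ hΩ ((closure_mono hwu).trans huΩ)
    exact (hu.abs.rpow_const fun _ => Or.inr hp.le).continuousOn.mul
      ((continuous_infDist_pt _).continuousOn.rpow_const fun x hx =>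
        Or.inl (infDist_compl_pos hΩ hne hx).ne')
  exact (hcont.integrable_of_hasCompactSupport (huc.mono hwu)).lintegral_lt_top

theorem AdmitsHardyWith.lintegral_le_of_upperGradient_le {β : ℝ} {C : ℝ≥0}
    (hHardy : AdmitsHardyWith μ Ω p β C) (hp : 0 < p) (hΩ : IsOpen Ω) (hne : Ωᶜ.Nonempty)
    {L : ℝ≥0} (huL : LipschitzWith L u) (huc : HasCompactSupport u) (huΩ : tsupport u ⊆ Ω)
    {g N : X → ℝ≥0∞} (hg : IsUpperGradient g u) {c : ℝ≥0∞} (hc : C * c ≤ 2⁻¹)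
    (hgN : ∀ x ∈ Ω, g x ^ p * ENNReal.ofReal (infDist x Ωᶜ ^ β) ≤
      c * ENNReal.ofReal (|u x| ^ p * infDist x Ωᶜ ^ (β - p)) + N x) :
    ∫⁻ x in Ω, ENNReal.ofReal (|u x| ^ p * infDist x Ωᶜ ^ (β - p)) ∂μ ≤
      2 * (C * ∫⁻ x in Ω, N x ∂μ) := by
  have hum : Measurable u := huL.continuous.measurable
  refine le_two_mul_of_le_half_mul_add ?_ ?_
  · exact ((setLIntegral_le_lintegral _ _).trans_lt
      (lintegral_abs_rpow_mul_infDist_rpow_lt_top hΩ hne hp huL.continuous huc huΩ _)).ne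
  set W := ∫⁻ x in Ω, ENNReal.ofReal (|u x| ^ p * infDist x Ωᶜ ^ (β - p)) ∂μ
  calc W ≤ C * ∫⁻ x in Ω, g x ^ p * ENNReal.ofReal (infDist x Ωᶜ ^ β) ∂μ :=
        hHardy u ⟨L, huL⟩ huc huΩ g hg
    _ ≤ C * (c * W + ∫⁻ x in Ω, N x ∂μ) := by
        rw [← lintegral_const_mul c (by fun_prop), ← lintegral_add_left (by fun_prop)]
        exact mul_le_mul' le_rfl (setLIntegral_mono' hΩ.measurableSet hgN)
    _ = C * c * W + C * ∫⁻ x in Ω, N x ∂μ := by ring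
    _ ≤ 2⁻¹ * W + C * ∫⁻ x in Ω, N x ∂μ := by gcongr

end Absorption

section Cutoff

/-- A cutoff function at scale `ρ`: it takes values in `[0, 1]`, is `ρ⁻¹`-Lipschitz, and is locally
constant off the closed set `A`. -/
structure IsCutoff {X : Type*} [PseudoMetricSpace X] (f : X → ℝ) (A : Set X) (ρ : ℝ) : Prop where
  pos : 0 < ρ
  mem_Icc : ∀ x, f x ∈ Icc 0 1
  lipschitz : LipschitzWith ρ⁻¹.toNNReal f
  isClosed : IsClosed A
  eventually_eq : ∀ x ∉ A, ∀ᶠ y in 𝓝 x, f y = f x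

namespace IsCutoff
variable {X : Type*} [PseudoMetricSpace X] {f : X → ℝ} {A : Set X} {ρ : ℝ}

theorem one_sub (hf : IsCutoff f A ρ) : IsCutoff (fun x => 1 - f x) A ρ where
  pos := hf.pos
  mem_Icc x := ⟨sub_nonneg.2 (hf.mem_Icc x).2, sub_le_self 1 (hf.mem_Icc x).1⟩
  lipschitz := by simpa only [zero_add] using (LipschitzWith.const 1).sub hf.lipschitz
  isClosed := hf.isClosed
  eventually_eq x hx := (hf.eventually_eq x hx).mono fun y hy => by rw [hy]

theorem hasLipBoundAt (hf : IsCutoff f A ρ) (x : X) :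
    HasLipBoundAt (A.indicator (fun _ => ρ⁻¹) x) f x := by
  by_cases hx : x ∈ A
  · have hLip := HasLipBoundAt.of_lipschitzWith hf.lipschitz x
    rwa [Real.coe_toNNReal _ (inv_nonneg.2 hf.pos.le), ← indicator_of_mem hx fun _ => ρ⁻¹] at hLip
  · rw [indicator_of_notMem hx]
    exact .of_eventually_eq (hf.eventually_eq x hx)

end IsCutoff

/-- The function of `dist · c` that is `1` on `closedBall c r₁`, vanishes off
`closedBall c (r₁ + r)` and is linear in between. -/
noncomputable def ballCutoff {X : Type*} [PseudoMetricSpace X] (c : X) (r₁ r : ℝ) (y : X) : ℝ :=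
  max 0 (min 1 ((r₁ + r - dist y c) / r))

variable {X : Type*} [PseudoMetricSpace X] {c y : X} {r₁ r : ℝ}

theorem ballCutoff_eq_one (hr : 0 < r) (hy : y ∈ closedBall c r₁) : ballCutoff c r₁ r y = 1 := by
  rw [ballCutoff, min_eq_left, max_eq_right zero_le_one]
  rw [le_div_iff₀ hr]
  linarith [mem_closedBall.1 hy]

theorem ballCutoff_eq_zero (hr : 0 < r) (hy : y ∉ closedBall c (r₁ + r)) :
    ballCutoff c r₁ r y = 0 := by
  rw [mem_closedBall, not_le] at hy
  exact max_eq_left ((min_le_right _ _).trans (div_nonpos_of_nonpos_of_nonneg (by linarith) hr.le))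

theorem isCutoff_ballCutoff (hr : 0 < r) :
    IsCutoff (ballCutoff c r₁ r) (closedBall c (r₁ + r)) r where
  pos := hr
  mem_Icc y := ⟨le_max_left _ _, max_le zero_le_one (min_le_left _ _)⟩
  lipschitz := by
    refine LipschitzWith.const_max (LipschitzWith.const_min (LipschitzWith.of_dist_le_mul
      fun x y => ?_) 1) 0
    rw [Real.coe_toNNReal _ (inv_nonneg.2 hr.le), Real.dist_eq, ← sub_div, sub_sub_sub_cancel_left,
      abs_div, abs_of_pos hr, div_eq_inv_mul, abs_sub_comm]
    gcongr
    exact abs_dist_sub_le x y c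
  isClosed := isClosed_closedBall
  eventually_eq y hy := by
    filter_upwards [isClosed_closedBall.isOpen_compl.mem_nhds hy] with z hz
    rw [ballCutoff_eq_zero hr hy, ballCutoff_eq_zero hr hz]

end Cutoff

section GradientEstimate

variable {θ d δ a p β τ ρ : ℝ}

theorem add_rpow_le_two_rpow_mul {a b p : ℝ} (ha : 0 ≤ a) (hb : 0 ≤ b) (hp : 0 ≤ p) :
    (a + b) ^ p ≤ 2 ^ p * (a ^ p + b ^ p) := by
  have hmax : (max a b) ^ p ≤ a ^ p + b ^ p := by
    rcases max_choice a b with h | h <;> rw [h]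
    · exact le_add_of_nonneg_right (by positivity)
    · exact le_add_of_nonneg_left (by positivity)
  calc (a + b) ^ p ≤ (2 * max a b) ^ p := by
        gcongr
        linarith [le_max_left a b, le_max_right a b]
    _ = 2 ^ p * max a b ^ p := Real.mul_rpow zero_le_two (ha.trans (le_max_left a b))
    _ ≤ 2 ^ p * (a ^ p + b ^ p) := by gcongr

theorem add_rpow_mul_rpow_le {F G : ℝ} (hp : 0 ≤ p) (hδ : 0 ≤ δ) (hθ : 0 ≤ θ) (hd : 0 < d)
    (hF : 0 ≤ F) (hG : 0 ≤ G) (n : ℕ) :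
    (θ ^ (n + 1) * (δ * F / d) + (n + 1) * (θ ^ n * F * G)) ^ p * d ^ β ≤
      2 ^ p * δ ^ p * ((θ ^ (n + 1) * F) ^ p * d ^ (β - p)) +
        2 ^ p * (n + 1) ^ p * ((θ ^ n * F * G) ^ p * d ^ β) := by
  have hfirst : (θ ^ (n + 1) * (δ * F / d)) ^ p * d ^ β =
      δ ^ p * ((θ ^ (n + 1) * F) ^ p * d ^ (β - p)) := by
    rw [show θ ^ (n + 1) * (δ * F / d) = δ * (θ ^ (n + 1) * F) / d by ring,
      Real.div_rpow (by positivity) hd.le, Real.mul_rpow hδ (by positivity), Real.rpow_sub hd]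
    ring
  calc (θ ^ (n + 1) * (δ * F / d) + (n + 1) * (θ ^ n * F * G)) ^ p * d ^ β
      ≤ 2 ^ p * ((θ ^ (n + 1) * (δ * F / d)) ^ p + ((n + 1) * (θ ^ n * F * G)) ^ p) * d ^ β := by
        gcongr
        exact add_rpow_le_two_rpow_mul (by positivity) (by positivity) hp
    _ = 2 ^ p * ((θ ^ (n + 1) * (δ * F / d)) ^ p * d ^ β) +
          2 ^ p * (n + 1) ^ p * ((θ ^ n * F * G) ^ p * d ^ β) := by
        rw [Real.mul_rpow (x := (n : ℝ) + 1) (by positivity) (by positivity)]; ring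
    _ = _ := by rw [hfirst]; ring

theorem pow_mul_peak_rpow_le_of_le (hp : 0 ≤ p) (hδ : 0 ≤ δ) (ha : 0 < a) (hθ : 0 < θ)
    (hθ1 : θ ≤ 1) (hd : 0 < d) (hdρ : d ≤ 8 * ρ) (hτ : 0 < τ) (hτ1 : τ ≤ 1) {n : ℕ}
    (hn : |β| + δ * p ≤ n * p) (h : τ * θ * ρ ≤ d) :
    (θ ^ n * peak δ a d * ρ⁻¹) ^ p * d ^ β ≤
      (8 / τ) ^ (n * p) * (peak δ a ρ ^ p * ρ ^ (β - p)) := by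
  have hρ : 0 < ρ := by linarith
  set κ := 8 / (τ * θ) with hκ
  have hκ8 : 8 ≤ κ := by
    rw [hκ, le_div_iff₀ (by positivity)]
    nlinarith
  have hdκ : d ≤ κ * ρ := hdρ.trans (by gcongr)
  have hρκ : ρ ≤ κ * d := by
    rw [hκ, div_mul_eq_mul_div, le_div_iff₀ (by positivity)]
    linarith
  have hpeakρ := peak_nonneg (δ := δ) ha hρ.le
  have hpeakd := peak_nonneg (δ := δ) ha hd.le
  calc (θ ^ n * peak δ a d * ρ⁻¹) ^ p * d ^ β
      ≤ (θ ^ n * (κ ^ δ * peak δ a ρ) * ρ⁻¹) ^ p * (κ ^ |β| * ρ ^ β) := by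
        gcongr
        · exact peak_le_rpow_mul_peak hδ ha hd hρ hdκ hρκ
        · exact rpow_le_rpow_abs_mul_rpow hd hρ hdκ hρκ β
    _ = θ ^ (n * p) * κ ^ (|β| + δ * p) * (peak δ a ρ ^ p * ρ ^ (β - p)) := by
        rw [Real.mul_rpow (by positivity) (by positivity), Real.mul_rpow (by positivity)
          (by positivity), Real.mul_rpow (by positivity) hpeakρ, Real.inv_rpow hρ.le,
          Real.rpow_sub hρ, Real.rpow_add (by positivity), Real.rpow_mul (x := κ) (by positivity),
          Real.rpow_mul hθ.le, Real.rpow_natCast]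
        ring
    _ ≤ θ ^ (n * p) * κ ^ (n * p) * (peak δ a ρ ^ p * ρ ^ (β - p)) := by
        gcongr
        linarith
    _ = (8 / τ) ^ (n * p) * (peak δ a ρ ^ p * ρ ^ (β - p)) := by
        rw [← Real.mul_rpow hθ.le (by positivity), hκ]
        field_simp

/- Where `d ≤ τ θ ρ`, the slope `ρ⁻¹` of a cutoff is at most `τ θ / d`, and the term is a small
multiple of the integrand that the Hardy inequality controls. Elsewhere `d` and `ρ` agree up to the
factor `8 / (τ θ)`, and the power `θ ^ n` compensates for the negative powers of `θ`. -/
theorem pow_mul_peak_rpow_le (hp : 0 < p) (hδ : 0 < δ) (ha : 0 < a) (hθ : 0 ≤ θ) (hθ1 : θ ≤ 1)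
    (hd : 0 < d) (hdρ : d ≤ 8 * ρ) (hτ : 0 < τ) (hτ1 : τ ≤ 1) {n : ℕ}
    (hn : |β| + δ * p ≤ n * p) :
    (θ ^ n * peak δ a d * ρ⁻¹) ^ p * d ^ β ≤
      τ ^ p * ((θ ^ (n + 1) * peak δ a d) ^ p * d ^ (β - p)) +
        (8 / τ) ^ (n * p) * (peak δ a ρ ^ p * ρ ^ (β - p)) := by
  have hρ : 0 < ρ := by linarith
  have hpeakρ := peak_nonneg (δ := δ) ha hρ.le
  have hpeakd := peak_nonneg (δ := δ) ha hd.le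
  rcases hθ.eq_or_lt with rfl | hθ
  · have hn0 : n ≠ 0 := by
      rintro rfl
      have : 0 < |β| + δ * p := by positivity
      simp only [Nat.cast_zero, zero_mul] at hn
      linarith
    rw [zero_pow hn0, zero_mul, zero_mul, Real.zero_rpow hp.ne', zero_mul]
    positivity
  rcases le_total (τ * θ * ρ) d with h | h
  · exact (pow_mul_peak_rpow_le_of_le hp.le hδ.le ha hθ hθ1 hd hdρ hτ hτ1 hn h).trans
      (le_add_of_nonneg_left (by positivity))
  · have hρd : ρ⁻¹ ≤ τ * θ / d := by
      rw [le_div_iff₀ hd, inv_mul_le_iff₀ hρ]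
      linarith
    calc (θ ^ n * peak δ a d * ρ⁻¹) ^ p * d ^ β
        ≤ (θ ^ n * peak δ a d * (τ * θ / d)) ^ p * d ^ β := by gcongr
      _ = τ ^ p * ((θ ^ (n + 1) * peak δ a d) ^ p * d ^ (β - p)) := by
          rw [show θ ^ n * peak δ a d * (τ * θ / d) = τ * (θ ^ (n + 1) * peak δ a d) / d by ring,
            Real.div_rpow (by positivity) hd.le, Real.mul_rpow hτ.le (by positivity),
            Real.rpow_sub hd]
          ring
      _ ≤ _ := le_add_of_nonneg_right (by positivity)

end GradientEstimate

section InfCutoff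

variable {X ι : Type*} [Fintype ι] [Nonempty ι]

/-- The pointwise minimum of a finite family of functions: for a family of cutoffs, the function
that cuts off wherever one of them does. -/
noncomputable def infCutoff (f : ι → X → ℝ) (x : X) : ℝ :=
  Finset.univ.inf' Finset.univ_nonempty fun i => f i x

/-- The largest slope `(ρ i)⁻¹` among the cutoffs that need not be constant near `x`, and `0` if
there is none: a bound for the pointwise Lipschitz constant of `infCutoff f`. -/
noncomputable def cutoffSlope (A : ι → Set X) (ρ : ι → ℝ) (x : X) : ℝ :=
  Finset.univ.sup' Finset.univ_nonempty fun i => (A i).indicator (fun _ => (ρ i)⁻¹) x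

theorem cutoffSlope_eq (A : ι → Set X) (ρ : ι → ℝ) (x : X) :
    cutoffSlope A ρ x = 0 ∨ ∃ i, x ∈ A i ∧ cutoffSlope A ρ x = (ρ i)⁻¹ := by
  obtain ⟨i, -, hi⟩ := Finset.univ.exists_mem_eq_sup' Finset.univ_nonempty
    fun i => (A i).indicator (fun _ => (ρ i)⁻¹) x
  by_cases hx : x ∈ A i
  · exact Or.inr ⟨i, hx, hi.trans (indicator_of_mem hx _)⟩
  · exact Or.inl (hi.trans (indicator_of_notMem hx _))

variable [MetricSpace X] {f : ι → X → ℝ} {A : ι → Set X} {ρ : ι → ℝ} {p β δ τ a : ℝ} {n : ℕ}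

theorem infCutoff_mem_Icc (hf : ∀ i, IsCutoff (f i) (A i) (ρ i)) (x : X) :
    infCutoff f x ∈ Icc 0 1 := by
  obtain ⟨i, -, hi⟩ := Finset.univ.exists_mem_eq_inf' Finset.univ_nonempty fun i => f i x
  rw [infCutoff, hi]
  exact (hf i).mem_Icc x

theorem exists_lipschitzWith_infCutoff (hf : ∀ i, IsCutoff (f i) (A i) (ρ i)) :
    ∃ L, LipschitzWith L (infCutoff f) := by
  have h : ∃ L, LipschitzWith L (Finset.univ.inf' Finset.univ_nonempty f) :=
    Finset.inf'_induction (p := fun g => ∃ L, LipschitzWith L g) _ _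
      (fun _ ⟨K, hK⟩ _ ⟨L, hL⟩ => ⟨max K L, hK.min hL⟩) fun i _ => ⟨_, (hf i).lipschitz⟩
  have heq : infCutoff f = Finset.univ.inf' Finset.univ_nonempty f :=
    funext fun x => (Finset.inf'_apply Finset.univ_nonempty f x).symm
  rwa [heq]

theorem cutoffSlope_nonneg (hf : ∀ i, IsCutoff (f i) (A i) (ρ i)) (x : X) :
    0 ≤ cutoffSlope A ρ x := by
  rcases cutoffSlope_eq A ρ x with h | ⟨i, -, h⟩ <;> rw [h]
  exact inv_nonneg.2 (hf i).pos.le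

theorem hasLipBoundAt_infCutoff (hf : ∀ i, IsCutoff (f i) (A i) (ρ i)) (x : X) :
    HasLipBoundAt (cutoffSlope A ρ x) (infCutoff f) x :=
  .inf' _ fun i hi => ((hf i).hasLipBoundAt x).mono
    (Finset.le_sup' (fun i => (A i).indicator (fun _ => (ρ i)⁻¹) x) hi)

theorem infCutoff_gradient_rpow_le (hp : 0 < p) (hδ : 0 < δ) (ha : 0 < a) (hτ : 0 < τ)
    (hτ1 : τ ≤ 1) (hn : |β| + δ * p ≤ n * p)
    (hf : ∀ i, IsCutoff (f i) (A i) (ρ i)) {d : ℝ} (hd : 0 < d) {x : X}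
    (hA : ∀ i, x ∈ A i → d ≤ 8 * ρ i) :
    ENNReal.ofReal ((infCutoff f x ^ n * peak δ a d * cutoffSlope A ρ x) ^ p * d ^ β) ≤
      ENNReal.ofReal (τ ^ p * ((infCutoff f x ^ (n + 1) * peak δ a d) ^ p * d ^ (β - p))) +
        ∑ i, (A i).indicator (fun _ =>
          ENNReal.ofReal ((8 / τ) ^ (n * p) * (peak δ a (ρ i) ^ p * ρ i ^ (β - p)))) x := by
  rcases cutoffSlope_eq A ρ x with h | ⟨i, hx, h⟩ <;> rw [h]
  · rw [mul_zero, Real.zero_rpow hp.ne', zero_mul, ENNReal.ofReal_zero]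
    exact zero_le
  calc _ ≤ _ := ENNReal.ofReal_le_ofReal (pow_mul_peak_rpow_le hp hδ ha (infCutoff_mem_Icc hf x).1
        (infCutoff_mem_Icc hf x).2 hd (hA i hx) hτ hτ1 hn)
    _ ≤ _ := ENNReal.ofReal_add_le
    _ ≤ _ := by
      gcongr
      refine le_trans (le_of_eq ?_) (Finset.single_le_sum (fun _ _ => zero_le) (Finset.mem_univ i))
      rw [indicator_of_mem hx]

theorem infCutoff_upperGradient_rpow_le (hp : 0 < p) (hδ : 0 < δ) (ha : 0 < a) (hτ : 0 < τ)
    (hτ1 : τ ≤ 1) (hn : |β| + δ * p ≤ n * p) (hf : ∀ i, IsCutoff (f i) (A i) (ρ i)) {d : ℝ}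
    (hd : 0 < d) {x : X} (hA : ∀ i, x ∈ A i → d ≤ 8 * ρ i) :
    ENNReal.ofReal (infCutoff f x ^ (n + 1) * (δ * peak δ a d / d) +
        (n + 1) * (infCutoff f x ^ n * peak δ a d * cutoffSlope A ρ x)) ^ p *
        ENNReal.ofReal (d ^ β) ≤
      ENNReal.ofReal (2 ^ p * δ ^ p + 2 ^ p * (n + 1) ^ p * τ ^ p) *
          ENNReal.ofReal ((infCutoff f x ^ (n + 1) * peak δ a d) ^ p * d ^ (β - p)) +
        ENNReal.ofReal (2 ^ p * (n + 1) ^ p) * ∑ i, (A i).indicator (fun _ =>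
          ENNReal.ofReal ((8 / τ) ^ (n * p) * (peak δ a (ρ i) ^ p * ρ i ^ (β - p)))) x := by
  have hθ := (infCutoff_mem_Icc hf x).1
  have hG := cutoffSlope_nonneg hf x
  have hF := peak_nonneg (δ := δ) ha hd.le
  have hslope := infCutoff_gradient_rpow_le hp hδ ha hτ hτ1 hn hf hd hA
  rw [ENNReal.ofReal_rpow_of_nonneg (by positivity) hp.le, ← ENNReal.ofReal_mul (by positivity)]
  refine (ENNReal.ofReal_le_ofReal (add_rpow_mul_rpow_le hp.le hδ.le hθ hd hF hG n)).trans ?_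
  rw [ENNReal.ofReal_mul (p := τ ^ p) (by positivity)] at hslope
  rw [ENNReal.ofReal_add (by positivity) (by positivity), ENNReal.ofReal_mul (by positivity),
    ENNReal.ofReal_mul (p := 2 ^ p * (n + 1) ^ p) (by positivity),
    ENNReal.ofReal_add (p := 2 ^ p * δ ^ p) (by positivity) (by positivity),
    ENNReal.ofReal_mul (p := 2 ^ p * (n + 1) ^ p) (q := τ ^ p) (by positivity), add_mul, add_assoc,
    mul_assoc (ENNReal.ofReal (2 ^ p * (n + 1) ^ p)), ← mul_add]
  gcongr

variable [MeasurableSpace X] [BorelSpace X] {Ω : Set X}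

theorem measurable_cutoffSlope (hf : ∀ i, IsCutoff (f i) (A i) (ρ i)) :
    Measurable (cutoffSlope A ρ) := by
  have h : Measurable (Finset.univ.sup' Finset.univ_nonempty fun i =>
      (A i).indicator fun _ : X => (ρ i)⁻¹) :=
    Finset.measurable_sup' _ fun i _ => measurable_const.indicator (hf i).isClosed.measurableSet
  convert h using 1
  exact funext fun x => (Finset.sup'_apply _ _ _).symm

theorem AdmitsHardyWith.lintegral_infCutoff_pow_mul_peak_le {μ : Measure X}
    [IsFiniteMeasureOnCompacts μ] {C : ℝ≥0} (hHardy : AdmitsHardyWith μ Ω p β C) (hp : 0 < p)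
    (hΩ : IsOpen Ω) (hne : Ωᶜ.Nonempty) (hδ : 0 < δ) (ha : 0 < a)
    (hτ : 0 < τ) (hτ1 : τ ≤ 1) (hn : |β| + δ * p ≤ n * p)
    (hC : C * ENNReal.ofReal (2 ^ p * δ ^ p + 2 ^ p * (n + 1) ^ p * τ ^ p) ≤ 2⁻¹)
    (hf : ∀ i, IsCutoff (f i) (A i) (ρ i)) (hA : ∀ i, ∀ x ∈ A i, infDist x Ωᶜ ≤ 8 * ρ i)
    (hfc : HasCompactSupport (infCutoff f)) (hfΩ : tsupport (infCutoff f) ⊆ Ω) :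
    ∫⁻ x in Ω, ENNReal.ofReal ((infCutoff f x ^ (n + 1) * peak δ a (infDist x Ωᶜ)) ^ p *
        infDist x Ωᶜ ^ (β - p)) ∂μ ≤
      2 * (C * (ENNReal.ofReal (2 ^ p * (n + 1) ^ p) * ∑ i, ENNReal.ofReal ((8 / τ) ^ (n * p) *
        (peak δ a (ρ i) ^ p * ρ i ^ (β - p))) * μ (A i))) := by
  obtain ⟨L, hL⟩ := exists_lipschitzWith_infCutoff hf
  have hθ := infCutoff_mem_Icc hf
  set u : X → ℝ := fun x => infCutoff f x ^ (n + 1) * peak δ a (infDist x Ωᶜ) with hu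
  set b : ι → ℝ≥0∞ := fun i =>
    ENNReal.ofReal ((8 / τ) ^ (n * p) * (peak δ a (ρ i) ^ p * ρ i ^ (β - p))) with hb
  have habs : ∀ x, |u x| = u x := fun x => abs_of_nonneg <|
    mul_nonneg (pow_nonneg (hθ x).1 _) (peak_nonneg ha infDist_nonneg)
  have hsupp : Function.support u ⊆ Function.support (infCutoff f) := fun x hx h0 => hx (by
    simp only [hu, h0, zero_pow n.succ_ne_zero, zero_mul])
  obtain ⟨K, hK⟩ := exists_lipschitzWith_pow_mul_peak_infDist hΩ hne hδ.le ha hL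
    (fun x => abs_le.2 ⟨by linarith [(hθ x).1], (hθ x).2⟩) hfc hfΩ n
  have hgrad := isUpperGradient_pow_mul_peak_infDist hΩ hne hδ.le ha hL hθ hfc hfΩ
    (measurable_cutoffSlope hf) (cutoffSlope_nonneg hf) (hasLipBoundAt_infCutoff hf) n
  have hmain := hHardy.lintegral_le_of_upperGradient_le (N := fun x =>
      ENNReal.ofReal (2 ^ p * (n + 1) ^ p) * ∑ i, (A i).indicator (fun _ => b i) x)
    hp hΩ hne hK (hfc.mono hsupp) ((closure_mono hsupp).trans hfΩ) hgrad hC fun x hx => by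
      rw [habs]
      exact infCutoff_upperGradient_rpow_le hp hδ ha hτ hτ1 hn hf (infDist_compl_pos hΩ hne hx)
        fun i hi => hA i x hi
  have hind : ∀ i, Measurable ((A i).indicator fun _ => b i) := fun i =>
    measurable_const.indicator (hf i).isClosed.measurableSet
  calc ∫⁻ x in Ω, ENNReal.ofReal (u x ^ p * infDist x Ωᶜ ^ (β - p)) ∂μ
      = ∫⁻ x in Ω, ENNReal.ofReal (|u x| ^ p * infDist x Ωᶜ ^ (β - p)) ∂μ := by simp only [habs]
    _ ≤ _ := hmain
    _ ≤ 2 * (C * ∫⁻ x, ENNReal.ofReal (2 ^ p * (n + 1) ^ p) *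
          ∑ i, (A i).indicator (fun _ => b i) x ∂μ) := by
        gcongr
        exact Measure.restrict_le_self
    _ = _ := by
        rw [lintegral_const_mul _ (by fun_prop), lintegral_finsetSum _ fun i _ => hind i]
        simp only [lintegral_indicator_const (hf _).isClosed.measurableSet, hb]

end InfCutoff

section Doubling

namespace IsDoublingWith
variable {X : Type*} [MetricSpace X] [MeasurableSpace X] {μ : Measure X} {C : ℝ≥0}

theorem measure_closedBall_two_pow_mul_le (h : IsDoublingWith μ C) (x : X) {r : ℝ} (hr : 0 < r)
    (m : ℕ) : μ (closedBall x (2 ^ m * r)) ≤ C ^ m * μ (closedBall x r) := by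
  induction m with
  | zero => simp only [pow_zero, one_mul, le_refl]
  | succ m ih =>
    calc μ (closedBall x (2 ^ (m + 1) * r)) = μ (closedBall x (2 * (2 ^ m * r))) := by
          rw [pow_succ', mul_assoc]
      _ ≤ C * μ (closedBall x (2 ^ m * r)) := h.doubling x _ (by positivity)
      _ ≤ C * (C ^ m * μ (closedBall x r)) := by gcongr
      _ = C ^ (m + 1) * μ (closedBall x r) := by rw [pow_succ', mul_assoc]

theorem isFiniteMeasureOnCompacts (h : IsDoublingWith μ C) : IsFiniteMeasureOnCompacts μ where
  lt_top_of_isCompact K hK := by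
    rcases K.eq_empty_or_nonempty with rfl | ⟨x, -⟩
    · rw [measure_empty]
      exact ENNReal.zero_lt_top
    · obtain ⟨r, hr, hKr⟩ := hK.isBounded.subset_closedBall_lt 0 x
      exact (measure_mono hKr).trans_lt (h.measure_lt_top x r hr)

variable [BorelSpace X]

theorem finite_of_pairwiseDisjoint_closedBall (h : IsDoublingWith μ C) {x : X} {R ε : ℝ}
    (hR : 0 < R) (hε : 0 < ε) {u : Set X} (hu : u ⊆ closedBall x R)
    (hdisj : u.PairwiseDisjoint fun y => closedBall y ε) : u.Finite := by
  obtain ⟨m, hm⟩ := pow_unbounded_of_one_lt (2 * R / ε) (one_lt_two (α := ℝ))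
  rw [div_lt_iff₀ hε] at hm
  have hlow : ∀ y : u, μ (closedBall x R) / (C : ℝ≥0∞) ^ m ≤ μ (closedBall (y : X) ε) := fun y =>
    ENNReal.div_le_of_le_mul' <| (measure_mono (closedBall_subset_closedBall'
      (by linarith [mem_closedBall'.1 (hu y.2)]))).trans
        (h.measure_closedBall_two_pow_mul_le y hε m)
  have hfin := Measure.finite_const_le_meas_of_disjoint_iUnion μ
    (ε := μ (closedBall x R) / (C : ℝ≥0∞) ^ m) (As := fun y : u => closedBall (y : X) ε)
    (ENNReal.div_pos (h.measure_pos x R hR).ne' (by finiteness))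
    (fun _ => isClosed_closedBall.measurableSet)
    (fun y z hyz => hdisj y.2 z.2 (Subtype.coe_injective.ne hyz))
    (ne_top_of_le_ne_top (h.measure_lt_top x (R + ε) (by positivity)).ne <| measure_mono <|
      iUnion_subset fun y => closedBall_subset_closedBall' <| by
        linarith [mem_closedBall.1 (hu y.2)])
  have : Finite u := finite_univ_iff.1 (hfin.subset fun y _ => hlow y)
  exact u.toFinite

theorem properSpace [CompleteSpace X] (h : IsDoublingWith μ C) : ProperSpace X := by
  refine ProperSpace.of_isCompact_closedBall_of_le 1 fun x R hR => ?_
  refine (totallyBounded_iff.2 fun ε hε => ?_).isCompact_of_isClosed isClosed_closedBall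
  obtain ⟨u, hu, hdisj, hcov⟩ := Vitali.exists_disjoint_subfamily_covering_enlargement_closedBall
    (closedBall x R) (fun y => y) (fun _ => ε / 8) (ε / 8) (fun _ _ => le_rfl) 4 (by norm_num)
  refine ⟨u, h.finite_of_pairwiseDisjoint_closedBall (by linarith) (by positivity) hu hdisj,
    fun y hy => ?_⟩
  obtain ⟨z, hz, hsub⟩ := hcov y hy
  refine mem_iUnion₂.2 ⟨z, hz, mem_ball.2 ?_⟩
  linarith [mem_closedBall.1 (hsub (mem_closedBall_self (by positivity)))]

end IsDoublingWith

end Doubling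

section Cocontent

variable {X : Type*} [MetricSpace X] [MeasurableSpace X] {μ : Measure X} {E E' : Set X}
  {R q s : ℝ}

theorem hausdorffCocontent_le_of_subset (hs : s ≤ q) (hE : E ⊆ E') :
    hausdorffCocontent μ R s E ≤ hausdorffCocontent μ (min R 1) q E' := by
  refine le_iInf₂ fun F hF => le_iInf₂ fun hFR hcov => ?_
  refine (iInf₂_le F hF).trans ((iInf₂_le
    (fun b hb => ⟨(hFR b hb).1, (hFR b hb).2.trans (min_le_left R 1)⟩) (hE.trans hcov)).trans ?_)
  refine ENNReal.tsum_le_tsum fun b => ?_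
  have hb := hFR b b.2
  gcongr ENNReal.ofReal ?_ * _
  exact Real.rpow_le_rpow_of_exponent_ge hb.1 (hb.2.trans (min_le_right R 1)) (by linarith)

theorem hausdorffCocontent_eq_zero_of_lt_codimH (hs : ENNReal.ofReal s < codimH μ E')
    (hE : E ⊆ E') (hR : 0 < R) : hausdorffCocontent μ R s E = 0 := by
  obtain ⟨q, hq⟩ := lt_iSup_iff.1 hs
  obtain ⟨hq, hsq⟩ := lt_iSup_iff.1 hq
  have hsq' : s ≤ q := Real.toNNReal_le_iff_le_coe.1 (ENNReal.coe_lt_coe.1 hsq).le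
  exact le_antisymm ((hausdorffCocontent_le_of_subset hsq' hE).trans (hq _ (by positivity)).le)
    zero_le

theorem measure_le_hausdorffCocontent (hs : 0 ≤ s) (hR : R ≤ 1) :
    μ E ≤ hausdorffCocontent μ R s E := by
  refine le_iInf₂ fun F hF => le_iInf₂ fun hFR hcov => ?_
  have : Countable F := hF
  rw [biUnion_eq_iUnion] at hcov
  refine (measure_mono hcov).trans ((measure_iUnion_le _).trans (ENNReal.tsum_le_tsum fun b => ?_))
  have hb := hFR b b.2
  exact le_mul_of_one_le_left' <| ENNReal.one_le_ofReal.2 <|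
    Real.one_le_rpow_of_pos_of_le_one_of_nonpos hb.1 (hb.2.trans hR) (neg_nonpos.2 hs)

theorem exists_finite_cover_sum_lt (hE : IsCompact E) (h0 : hausdorffCocontent μ R s E = 0)
    {η : ℝ≥0∞} (hη : 0 < η) :
    ∃ F : Finset (X × ℝ), (∀ b ∈ F, 0 < b.2 ∧ b.2 ≤ R ∧ (closedBall b.1 b.2 ∩ E).Nonempty) ∧
      (E ⊆ ⋃ b ∈ F, ball b.1 (2 * b.2)) ∧
      ∑ b ∈ F, ENNReal.ofReal (b.2 ^ (-s)) * μ (closedBall b.1 b.2) < η := by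
  rw [← h0, hausdorffCocontent] at hη
  simp only [iInf_lt_iff] at hη
  obtain ⟨F₀, -, hF₀, hcov, hlt⟩ := hη
  obtain ⟨F, hFsub, hFfin, hFcov⟩ := hE.elim_finite_subcover_image
    (b := {b ∈ F₀ | (closedBall b.1 b.2 ∩ E).Nonempty}) (c := fun b => ball b.1 (2 * b.2))
    (fun _ _ => isOpen_ball) fun x hx => by
      obtain ⟨b, hb, hxb⟩ := mem_iUnion₂.1 (hcov hx)
      refine mem_iUnion₂.2 ⟨b, ⟨hb, x, hxb, hx⟩, mem_ball.2 ?_⟩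
      linarith [mem_closedBall.1 hxb, (hF₀ b hb).1]
  lift F to Finset (X × ℝ) using hFfin
  refine ⟨F, fun b hb => ⟨(hF₀ b (hFsub hb).1).1, (hF₀ b (hFsub hb).1).2, (hFsub hb).2⟩, hFcov,
    lt_of_le_of_lt ?_ hlt⟩
  rw [tsum_subtype F₀ fun b : X × ℝ => ENNReal.ofReal (b.2 ^ (-s)) * μ (closedBall b.1 b.2)]
  refine le_trans (Finset.sum_le_sum fun b hb => ?_) (ENNReal.sum_le_tsum F)
  rw [indicator_of_mem (hFsub hb).1]

theorem IsDoublingWith.exists_finite_cover {C : ℝ≥0} (h : IsDoublingWith μ C) (hE : IsCompact E)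
    (h0 : hausdorffCocontent μ R s E = 0) {η : ℝ≥0∞} (hη : 0 < η) :
    ∃ F : Finset (X × ℝ), (∀ b ∈ F, 0 < b.2 ∧ b.2 ≤ R ∧ (closedBall b.1 b.2 ∩ E).Nonempty) ∧
      (E ⊆ ⋃ b ∈ F, ball b.1 (2 * b.2)) ∧
      ∑ b ∈ F, ENNReal.ofReal (b.2 ^ (-s)) * μ (closedBall b.1 (3 * b.2)) ≤ η := by
  obtain ⟨F, hF, hcov, hsum⟩ := exists_finite_cover_sum_lt hE h0
    (η := η / (C : ℝ≥0∞) ^ 2) (ENNReal.div_pos hη.ne' (by finiteness))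
  refine ⟨F, hF, hcov, ?_⟩
  calc ∑ b ∈ F, ENNReal.ofReal (b.2 ^ (-s)) * μ (closedBall b.1 (3 * b.2))
      ≤ ∑ b ∈ F, C ^ 2 * (ENNReal.ofReal (b.2 ^ (-s)) * μ (closedBall b.1 b.2)) := by
        refine Finset.sum_le_sum fun b hb => ?_
        have hb0 := (hF b hb).1
        rw [mul_left_comm]
        gcongr
        exact (measure_mono (closedBall_subset_closedBall (by linarith))).trans
          (h.measure_closedBall_two_pow_mul_le b.1 hb0 2)
    _ ≤ C ^ 2 * (η / C ^ 2) := by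
        rw [← Finset.mul_sum]
        gcongr
    _ ≤ η := ENNReal.mul_div_le

end Cocontent

section PerforatedBall

variable {X ι : Type*} [MetricSpace X] {c y : X} {r₁ r : ℝ} {z : ι → X} {ρ : ι → ℝ}

/-- The cutoffs whose minimum is `1` on the points of `closedBall c r₁` far from the centres `z i`,
and vanishes off `closedBall c (r₁ + r)` and on each `closedBall (z i) (2 * ρ i)`. -/
noncomputable def perforatedCutoff (c : X) (r₁ r : ℝ) (z : ι → X) (ρ : ι → ℝ) :
    Option ι → X → ℝ
  | none => ballCutoff c r₁ r
  | some i => fun y => 1 - ballCutoff (z i) (2 * ρ i) (ρ i) y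

/-- The balls off which the functions `perforatedCutoff c r₁ r z ρ` are locally constant. -/
def perforatedBall (c : X) (r₁ r : ℝ) (z : ι → X) (ρ : ι → ℝ) : Option ι → Set X
  | none => closedBall c (r₁ + r)
  | some i => closedBall (z i) (3 * ρ i)

theorem isCutoff_perforatedCutoff (hr : 0 < r) (hρ : ∀ i, 0 < ρ i) (i : Option ι) :
    IsCutoff (perforatedCutoff c r₁ r z ρ i) (perforatedBall c r₁ r z ρ i) (i.elim r ρ) := by
  rcases i with _ | i
  · exact isCutoff_ballCutoff hr
  · have h : IsCutoff (ballCutoff (z i) (2 * ρ i) (ρ i)) _ (ρ i) := isCutoff_ballCutoff (hρ i)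
    rw [show 2 * ρ i + ρ i = 3 * ρ i by ring] at h
    exact h.one_sub

theorem infDist_le_add_of_mem_closedBall {E : Set X} {R : ℝ} (hE : (closedBall c r ∩ E).Nonempty)
    (hy : y ∈ closedBall c R) : infDist y E ≤ R + r := by
  obtain ⟨w, hwc, hwE⟩ := hE
  exact (infDist_le_dist_of_mem hwE).trans
    ((dist_triangle_right y w c).trans (add_le_add (mem_closedBall.1 hy) (mem_closedBall.1 hwc)))

theorem infDist_le_of_mem_perforatedBall {E : Set X} (hρ : ∀ i, 0 < ρ i)
    (hc : (closedBall c (4 * r) ∩ E).Nonempty) (hz : ∀ i, (closedBall (z i) (ρ i) ∩ E).Nonempty)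
    (i : Option ι) (hy : y ∈ perforatedBall c (3 * r) r z ρ i) :
    infDist y E ≤ 8 * i.elim r ρ := by
  rcases i with _ | i
  · have hyE : infDist y E ≤ 3 * r + r + 4 * r := infDist_le_add_of_mem_closedBall hc hy
    exact hyE.trans_eq (by simp only [Option.elim_none]; ring)
  · have hyE : infDist y E ≤ 3 * ρ i + ρ i := infDist_le_add_of_mem_closedBall (hz i) hy
    exact hyE.trans (by simp only [Option.elim_some]; linarith [hρ i])

variable [Fintype ι]

theorem infCutoff_perforatedCutoff_eq_one (hr : 0 < r) (hρ : ∀ i, 0 < ρ i)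
    (hy : y ∈ closedBall c r₁) (hyz : ∀ i, y ∉ closedBall (z i) (3 * ρ i)) :
    infCutoff (perforatedCutoff c r₁ r z ρ) y = 1 := by
  have h : ∀ i : Option ι, perforatedCutoff c r₁ r z ρ i y = 1 := by
    rintro (_ | i)
    · exact ballCutoff_eq_one hr hy
    · have hyi := hyz i
      rw [show 3 * ρ i = 2 * ρ i + ρ i by ring] at hyi
      simp only [perforatedCutoff, ballCutoff_eq_zero (hρ i) hyi, sub_zero]
  simp only [infCutoff, h, Finset.inf'_const]

theorem tsupport_infCutoff_perforatedCutoff_subset (hr : 0 < r) (hρ : ∀ i, 0 < ρ i) :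
    tsupport (infCutoff (perforatedCutoff c r₁ r z ρ)) ⊆
      closedBall c (r₁ + r) \ ⋃ i, ball (z i) (2 * ρ i) := by
  have hclosed : IsClosed (closedBall c (r₁ + r) \ ⋃ i, ball (z i) (2 * ρ i)) :=
    isClosed_closedBall.sdiff (isOpen_iUnion fun _ => isOpen_ball)
  refine closure_minimal (fun x hx => ?_) hclosed
  have hzero : ∀ i, perforatedCutoff c r₁ r z ρ i x ≠ 0 := fun i hi => hx <| le_antisymm
    ((Finset.inf'_le _ (Finset.mem_univ i)).trans hi.le)
    (infCutoff_mem_Icc (isCutoff_perforatedCutoff hr hρ) x).1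
  refine ⟨not_imp_comm.1 (ballCutoff_eq_zero hr) (hzero none), fun hxz => ?_⟩
  obtain ⟨i, hi⟩ := mem_iUnion.1 hxz
  refine hzero (some i) ?_
  simp only [perforatedCutoff, ballCutoff_eq_one (hρ i) (ball_subset_closedBall hi), sub_self]

variable [MeasurableSpace X] [BorelSpace X] {μ : Measure X} {Ω : Set X} {p β δ : ℝ} {C : ℝ≥0}

theorem exists_pow_and_rpow_le (hp : 0 < p) (hC : C * (2 ^ p * δ ^ p) < 2⁻¹) (β : ℝ) :
    ∃ (n : ℕ) (τ : ℝ), |β| + δ * p ≤ n * p ∧ 0 < τ ∧ τ ≤ 1 ∧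
      C * ENNReal.ofReal (2 ^ p * δ ^ p + 2 ^ p * (n + 1) ^ p * τ ^ p) ≤ 2⁻¹ := by
  obtain ⟨n, hn⟩ := exists_nat_ge ((|β| + δ * p) / p)
  have hlim : Tendsto (fun τ : ℝ => C * (2 ^ p * δ ^ p + 2 ^ p * (n + 1) ^ p * τ ^ p)) (𝓝[>] 0)
      (𝓝 (C * (2 ^ p * δ ^ p))) := by
    have hcont : Continuous fun τ : ℝ => τ ^ p := Real.continuous_rpow_const hp.le
    exact (Continuous.tendsto' (by fun_prop) _ _
      (by rw [Real.zero_rpow hp.ne', mul_zero, add_zero])).mono_left nhdsWithin_le_nhds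
  obtain ⟨τ, hτ, hτ0, hτ1⟩ :=
    ((hlim.eventually_le_const hC).and (Ioc_mem_nhdsGT one_pos)).exists
  refine ⟨n, τ, (div_le_iff₀ hp).1 hn, hτ0, hτ1, ?_⟩
  rw [← ENNReal.ofReal_coe_nnreal, ← ENNReal.ofReal_mul C.coe_nonneg]
  exact (ENNReal.ofReal_le_ofReal hτ).trans_eq
    (by rw [ENNReal.ofReal_inv_of_pos two_pos, ENNReal.ofReal_ofNat])

theorem AdmitsHardyWith.exists_setLIntegral_peak_le [ProperSpace X] [IsFiniteMeasureOnCompacts μ]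
    (hHardy : AdmitsHardyWith μ Ω p β C) (hp : 0 < p) (hΩ : IsOpen Ω) (hδ : 0 < δ)
    (hC : C * (2 ^ p * δ ^ p) < 2⁻¹) :
    ∃ K : ℝ≥0, ∀ {ι : Type*} [Fintype ι] {c : X} {r a : ℝ} {z : ι → X} {ρ : ι → ℝ} {T : Set X},
      0 < r → 0 < a → (∀ i, 0 < ρ i) → (closedBall c (4 * r) ∩ Ωᶜ).Nonempty →
      (∀ i, (closedBall (z i) (ρ i) ∩ Ωᶜ).Nonempty) →
      closedBall c (4 * r) ∩ Ωᶜ ⊆ ⋃ i, ball (z i) (2 * ρ i) → MeasurableSet T →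
      T ⊆ closedBall c (3 * r) → (∀ i, Disjoint T (closedBall (z i) (3 * ρ i))) → T ⊆ Ω →
      ∫⁻ x in T, ENNReal.ofReal (peak δ a (infDist x Ωᶜ) ^ p * infDist x Ωᶜ ^ (β - p)) ∂μ ≤
        K * (ENNReal.ofReal (peak δ a r ^ p * r ^ (β - p)) * μ (closedBall c (4 * r)) +
          ∑ i, ENNReal.ofReal (peak δ a (ρ i) ^ p * ρ i ^ (β - p)) *
            μ (closedBall (z i) (3 * ρ i))) := by
  obtain ⟨n, τ, hn, hτ, hτ1, hCτ⟩ := exists_pow_and_rpow_le hp hC β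
  refine ⟨2 * C * (2 ^ p * (n + 1 : ℝ) ^ p).toNNReal * ((8 / τ) ^ (n * p)).toNNReal,
    fun {ι _ c r a z ρ T} hr ha hρ hc hz hcov hT hTc hTz hTΩ => ?_⟩
  have hsum : 3 * r + r = 4 * r := by ring
  have htsupp := tsupport_infCutoff_perforatedCutoff_subset (c := c) (r₁ := 3 * r) (z := z) hr hρ
  rw [hsum] at htsupp
  have hmain := hHardy.lintegral_infCutoff_pow_mul_peak_le hp hΩ (hc.mono inter_subset_right) hδ ha
    hτ hτ1 hn hCτ (isCutoff_perforatedCutoff (c := c) (r₁ := 3 * r) (z := z) hr hρ)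
    (fun i x hx => infDist_le_of_mem_perforatedBall hρ hc hz i hx)
    ((isCompact_closedBall c _).of_isClosed_subset (isClosed_tsupport _)
      (htsupp.trans sdiff_subset))
    fun x hx => by_contra fun hxΩ => (htsupp hx).2 (hcov ⟨(htsupp hx).1, hxΩ⟩)
  calc ∫⁻ x in T, ENNReal.ofReal (peak δ a (infDist x Ωᶜ) ^ p * infDist x Ωᶜ ^ (β - p)) ∂μ
      = ∫⁻ x in T, ENNReal.ofReal ((infCutoff (perforatedCutoff c (3 * r) r z ρ) x ^ (n + 1) *
          peak δ a (infDist x Ωᶜ)) ^ p * infDist x Ωᶜ ^ (β - p)) ∂μ :=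
        setLIntegral_congr_fun hT fun x hx => by
          simp only [infCutoff_perforatedCutoff_eq_one hr hρ (hTc hx)
            fun i => disjoint_left.1 (hTz i) hx, one_pow, one_mul]
    _ ≤ _ := (lintegral_mono_set hTΩ).trans hmain
    _ = _ := by
        have hD : 0 ≤ (8 / τ) ^ (n * p) := by positivity
        simp only [ENNReal.ofReal_mul hD, mul_assoc, ← Finset.mul_sum, Fintype.sum_option,
          perforatedBall, Option.elim, hsum, ENNReal.coe_mul, ENNReal.coe_ofNat]
        rfl

end PerforatedBall

section Thickening

section PeakPower

variable {p β δ a s : ℝ}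

theorem rpow_le_two_rpow_mul_peak_rpow {d : ℝ} (hp : 0 ≤ p) (hδ : 0 ≤ δ)
    (ht : 0 ≤ p - β + δ * p) (ha : 0 < a) (had : a ≤ d) (hds : d ≤ s) :
    s ^ (-(p - β + δ * p)) ≤ 2 ^ p * (peak δ a d ^ p * d ^ (β - p)) := by
  have hd : 0 < d := ha.trans_le had
  calc s ^ (-(p - β + δ * p)) ≤ d ^ (-(p - β + δ * p)) :=
        Real.rpow_le_rpow_of_nonpos hd hds (neg_nonpos.2 ht)
    _ = (2 * (d ^ (-δ) / 2)) ^ p * d ^ (β - p) := by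
        rw [mul_div_cancel₀ _ two_ne_zero, ← Real.rpow_mul hd.le, ← Real.rpow_add hd]
        ring_nf
    _ ≤ (2 * peak δ a d) ^ p * d ^ (β - p) := by
        gcongr
        exact rpow_neg_div_two_le_peak hδ ha had
    _ = 2 ^ p * (peak δ a d ^ p * d ^ (β - p)) := by
        rw [Real.mul_rpow two_pos.le (peak_nonneg ha hd.le), mul_assoc]

theorem peak_rpow_mul_rpow_le_rpow_neg (hp : 0 ≤ p) (ha : 0 < a) (hs : 0 < s) :
    peak δ a s ^ p * s ^ (β - p) ≤ s ^ (-(p - β + δ * p)) := by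
  calc peak δ a s ^ p * s ^ (β - p) ≤ (s ^ (-δ)) ^ p * s ^ (β - p) := by
        gcongr
        · exact peak_nonneg ha hs.le
        · exact peak_le_rpow_neg ha hs
    _ = s ^ (-(p - β + δ * p)) := by
        rw [← Real.rpow_mul hs.le, ← Real.rpow_add hs]
        ring_nf

theorem peak_rpow_mul_rpow_le_mul_rpow (hp : 0 ≤ p) (ha : 0 < a) (hs : 0 < s) :
    peak δ a s ^ p * s ^ (β - p) ≤ (a ^ (-2 * δ)) ^ p * s ^ (-(p - β - δ * p)) := by
  calc peak δ a s ^ p * s ^ (β - p) ≤ (a ^ (-2 * δ) * s ^ δ) ^ p * s ^ (β - p) := by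
        gcongr
        · exact peak_nonneg ha hs.le
        · exact peak_le_mul_rpow ha hs
    _ = (a ^ (-2 * δ)) ^ p * s ^ (-(p - β - δ * p)) := by
        rw [Real.mul_rpow (by positivity) (by positivity), ← Real.rpow_mul hs.le, mul_assoc,
          ← Real.rpow_add hs]
        ring_nf

end PeakPower

variable {X : Type*} [MetricSpace X] {Ω E : Set X} {p β δ : ℝ} {C C_D : ℝ≥0}

/-- The points of `B` whose distance to the complement of `Ω` lies in `[a, s)`. -/
def layer (Ω : Set X) (a s : ℝ) (B : Set X) : Set X :=
  {y ∈ B | a ≤ infDist y Ωᶜ ∧ infDist y Ωᶜ < s}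

theorem layer_subset {a s : ℝ} {B : Set X} (ha : 0 < a) : layer Ω a s B ⊆ Ω := fun _ hy =>
  by_contra fun hyΩ => (ha.trans_le hy.2.1).ne' (infDist_zero_of_mem hyΩ)

variable [MeasurableSpace X] {μ : Measure X}

theorem IsDoublingWith.exists_finite_cover_sum_peak_le (h : IsDoublingWith μ C_D)
    (hE : IsCompact E) (hp : 0 ≤ p) {a R : ℝ} (ha : 0 < a)
    (h0 : hausdorffCocontent μ R (p - β - δ * p) E = 0) {η : ℝ≥0∞} (hη : 0 < η) :
    ∃ F : Finset (X × ℝ), (∀ b ∈ F, 0 < b.2 ∧ b.2 ≤ R ∧ (closedBall b.1 b.2 ∩ E).Nonempty) ∧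
      (E ⊆ ⋃ b ∈ F, ball b.1 (2 * b.2)) ∧
      ∑ b ∈ F, ENNReal.ofReal (peak δ a b.2 ^ p * b.2 ^ (β - p)) * μ (closedBall b.1 (3 * b.2))
        ≤ η := by
  have hA : 0 ≤ (a ^ (-2 * δ)) ^ p := by positivity
  obtain ⟨F, hF, hcov, hsum⟩ := h.exists_finite_cover hE h0
    (ENNReal.div_pos hη.ne' (ENNReal.ofReal_ne_top (r := (a ^ (-2 * δ)) ^ p)))
  refine ⟨F, hF, hcov, ?_⟩
  calc ∑ b ∈ F, ENNReal.ofReal (peak δ a b.2 ^ p * b.2 ^ (β - p)) * μ (closedBall b.1 (3 * b.2))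
      ≤ ∑ b ∈ F, ENNReal.ofReal ((a ^ (-2 * δ)) ^ p) *
          (ENNReal.ofReal (b.2 ^ (-(p - β - δ * p))) * μ (closedBall b.1 (3 * b.2))) := by
        refine Finset.sum_le_sum fun b hb => ?_
        rw [← mul_assoc, ← ENNReal.ofReal_mul hA]
        gcongr ENNReal.ofReal ?_ * _
        exact peak_rpow_mul_rpow_le_mul_rpow hp ha (hF b hb).1
    _ ≤ ENNReal.ofReal ((a ^ (-2 * δ)) ^ p) * (η / ENNReal.ofReal ((a ^ (-2 * δ)) ^ p)) := by
        rw [← Finset.mul_sum]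
        gcongr
    _ ≤ η := ENNReal.mul_div_le

variable [CompleteSpace X] [BorelSpace X]

theorem AdmitsHardyWith.exists_setLIntegral_layer_le (hHardy : AdmitsHardyWith μ Ω p β C)
    (h : IsDoublingWith μ C_D) (hp : 0 < p) (hΩ : IsOpen Ω) (hδ : 0 < δ)
    (hC : C * (2 ^ p * δ ^ p) < 2⁻¹) :
    ∃ K : ℝ≥0, ∀ {c : X} {r a s : ℝ}, 0 < r → 0 < a →
      (∀ R : ℝ, 0 < R → hausdorffCocontent μ R (p - β - δ * p) (closedBall c (4 * r) ∩ Ωᶜ) = 0) →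
      (closedBall c (4 * r) ∩ Ωᶜ).Nonempty →
      ∫⁻ x in layer Ω a s (closedBall c (3 * r)),
          ENNReal.ofReal (peak δ a (infDist x Ωᶜ) ^ p * infDist x Ωᶜ ^ (β - p)) ∂μ ≤
        K * (ENNReal.ofReal (r ^ (-(p - β + δ * p))) * μ (closedBall c (4 * r))) := by
  have := h.properSpace
  have := h.isFiniteMeasureOnCompacts
  obtain ⟨K, hK⟩ := hHardy.exists_setLIntegral_peak_le hp hΩ hδ hC
  refine ⟨K * 2, fun {c r a s} hr ha h0 hc => ?_⟩
  set M := ENNReal.ofReal (r ^ (-(p - β + δ * p))) * μ (closedBall c (4 * r))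
  have hM0 : 0 < M := ENNReal.mul_pos (ENNReal.ofReal_pos.2 (by positivity)).ne'
    (h.measure_pos c _ (by positivity)).ne'
  -- Balls of radius at most `a / 8` that meet `Ωᶜ` stay, even enlarged, away from the layer.
  obtain ⟨F, hF, hcov, hsum⟩ := h.exists_finite_cover_sum_peak_le
    ((isCompact_closedBall c (4 * r)).inter_right hΩ.isClosed_compl) hp.le ha
    (h0 (a / 8) (by positivity)) hM0
  have hFΩ : ∀ b : F, (closedBall b.1.1 b.1.2 ∩ Ωᶜ).Nonempty := fun b =>
    (hF b b.2).2.2.mono fun _ hy => ⟨hy.1, hy.2.2⟩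
  have hdisj : ∀ b : F,
      Disjoint (layer Ω a s (closedBall c (3 * r))) (closedBall b.1.1 (3 * b.1.2)) := fun b =>
    disjoint_left.2 fun y hy hyb => by
      linarith [infDist_le_add_of_mem_closedBall (hFΩ b) hyb, hy.2.1, hF b b.2]
  have hmeas : MeasurableSet (layer Ω a s (closedBall c (3 * r))) :=
    isClosed_closedBall.measurableSet.inter
      ((measurableSet_le measurable_const measurable_infDist).inter
        (measurableSet_lt measurable_infDist measurable_const))
  rw [← Finset.sum_coe_sort F] at hsum
  calc _ ≤ K * (ENNReal.ofReal (peak δ a r ^ p * r ^ (β - p)) * μ (closedBall c (4 * r)) +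
          ∑ b : F, ENNReal.ofReal (peak δ a b.1.2 ^ p * b.1.2 ^ (β - p)) *
            μ (closedBall b.1.1 (3 * b.1.2))) :=
        hK hr ha (fun b => (hF b b.2).1) hc hFΩ (hcov.trans (biUnion_eq_iUnion _ _).subset)
          hmeas (sep_subset _ _) hdisj (layer_subset ha)
    _ ≤ K * (M + M) := by
        gcongr
        exact mul_le_mul_left (ENNReal.ofReal_le_ofReal
          (peak_rpow_mul_rpow_le_rpow_neg hp.le ha hr)) _
    _ = (K * 2 : ℝ≥0) * M := by rw [← two_mul, ENNReal.coe_mul, ENNReal.coe_ofNat, mul_assoc]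

theorem AdmitsHardyWith.exists_measure_layer_le (hHardy : AdmitsHardyWith μ Ω p β C)
    (h : IsDoublingWith μ C_D) (hp : 0 < p) (hΩ : IsOpen Ω) (hδ : 0 < δ)
    (hC : C * (2 ^ p * δ ^ p) < 2⁻¹) (ht : 0 ≤ p - β + δ * p) :
    ∃ K : ℝ≥0, ∀ {c : X} {r a s : ℝ}, 0 < r → 0 < a → 0 < s →
      (∀ R : ℝ, 0 < R → hausdorffCocontent μ R (p - β - δ * p) (closedBall c (4 * r) ∩ Ωᶜ) = 0) →
      (closedBall c (4 * r) ∩ Ωᶜ).Nonempty →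
      μ (layer Ω a s (closedBall c (3 * r))) ≤
        ENNReal.ofReal (K * (s / r) ^ (p - β + δ * p)) * μ (closedBall c (4 * r)) := by
  obtain ⟨K, hK⟩ := hHardy.exists_setLIntegral_layer_le h hp hΩ hδ hC
  refine ⟨2 ^ p * K, fun {c r a s} hr ha hs h0 hc => ?_⟩
  set t := p - β + δ * p
  set T := layer Ω a s (closedBall c (3 * r))
  have hlow : ENNReal.ofReal (s ^ (-t)) * μ T ≤
      ENNReal.ofReal (2 ^ p) * (K * (ENNReal.ofReal (r ^ (-t)) * μ (closedBall c (4 * r)))) := by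
    calc ENNReal.ofReal (s ^ (-t)) * μ T = ∫⁻ _ in T, ENNReal.ofReal (s ^ (-t)) ∂μ :=
          (setLIntegral_const _ _).symm
      _ ≤ ∫⁻ x in T, ENNReal.ofReal (2 ^ p) *
          ENNReal.ofReal (peak δ a (infDist x Ωᶜ) ^ p * infDist x Ωᶜ ^ (β - p)) ∂μ := by
          have := measurable_peak (δ := δ) (a := a)
          refine setLIntegral_mono (by fun_prop) fun x hx => ?_
          rw [← ENNReal.ofReal_mul (by positivity)]
          exact ENNReal.ofReal_le_ofReal
            (rpow_le_two_rpow_mul_peak_rpow hp.le hδ.le ht ha hx.2.1 hx.2.2.le)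
      _ = ENNReal.ofReal (2 ^ p) * ∫⁻ x in T,
          ENNReal.ofReal (peak δ a (infDist x Ωᶜ) ^ p * infDist x Ωᶜ ^ (β - p)) ∂μ :=
          lintegral_const_mul' _ _ ENNReal.ofReal_ne_top
      _ ≤ _ := by gcongr; exact hK hr ha h0 hc
  calc μ T = ENNReal.ofReal (s ^ t) * (ENNReal.ofReal (s ^ (-t)) * μ T) := by
        rw [← mul_assoc, ← ENNReal.ofReal_mul (by positivity), ← Real.rpow_add hs, add_neg_cancel,
          Real.rpow_zero, ENNReal.ofReal_one, one_mul]
    _ ≤ ENNReal.ofReal (s ^ t) * (ENNReal.ofReal (2 ^ p) *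
          (K * (ENNReal.ofReal (r ^ (-t)) * μ (closedBall c (4 * r))))) := by gcongr
    _ = ENNReal.ofReal ((2 ^ p * K : ℝ≥0) * (s / r) ^ t) * μ (closedBall c (4 * r)) := by
        rw [← ENNReal.ofReal_coe_nnreal (p := K), ← mul_assoc, ← mul_assoc, ← mul_assoc,
          ← ENNReal.ofReal_mul (by positivity), ← ENNReal.ofReal_mul (by positivity),
          ← ENNReal.ofReal_mul (by positivity), Real.div_rpow hs.le hr.le, Real.rpow_neg hr.le]
        congr 2
        push_cast
        ring

theorem AdmitsHardyWith.exists_measure_thickening_le (hHardy : AdmitsHardyWith μ Ω p β C)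
    (h : IsDoublingWith μ C_D) (hp : 0 < p) (hΩ : IsOpen Ω) (hδ : 0 < δ)
    (hC : C * (2 ^ p * δ ^ p) < 2⁻¹) (hq : 0 ≤ p - β - δ * p) :
    ∃ K : ℝ≥0, ∀ {c : X} {r s : ℝ}, 0 < r → 0 < s →
      (∀ R : ℝ, 0 < R → hausdorffCocontent μ R (p - β - δ * p) (closedBall c (4 * r) ∩ Ωᶜ) = 0) →
      (closedBall c (4 * r) ∩ Ωᶜ).Nonempty →
      μ (thickening s Ωᶜ ∩ closedBall c (3 * r)) ≤
        ENNReal.ofReal (K * (s / r) ^ (p - β + δ * p)) * μ (closedBall c (4 * r)) := by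
  have hδp : 0 < δ * p := by positivity
  obtain ⟨K, hK⟩ := hHardy.exists_measure_layer_le h hp hΩ hδ hC (by linarith)
  refine ⟨K, fun {c r s} hr hs h0 hc => ?_⟩
  have hnull : μ (closedBall c (4 * r) ∩ Ωᶜ) = 0 :=
    le_antisymm ((measure_le_hausdorffCocontent hq le_rfl).trans (h0 1 one_pos).le) zero_le
  have hmono : Monotone fun m : ℕ => layer Ω (1 / (m + 1 : ℝ)) s (closedBall c (3 * r)) :=
    fun m k hmk y hy => ⟨hy.1, (by gcongr : 1 / (k + 1 : ℝ) ≤ 1 / (m + 1)).trans hy.2.1, hy.2.2⟩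
  have hsub : thickening s Ωᶜ ∩ closedBall c (3 * r) ⊆ (closedBall c (4 * r) ∩ Ωᶜ) ∪
      ⋃ m : ℕ, layer Ω (1 / (m + 1 : ℝ)) s (closedBall c (3 * r)) := by
    rintro y ⟨hys, hyc⟩
    by_cases hyΩ : y ∈ Ω
    · obtain ⟨m, hm⟩ := exists_nat_one_div_lt
        (infDist_compl_pos hΩ (hc.mono inter_subset_right) hyΩ)
      obtain ⟨w, hw, hyw⟩ := mem_thickening_iff.1 hys
      exact Or.inr (mem_iUnion.2 ⟨m, hyc, hm.le, (infDist_le_dist_of_mem hw).trans_lt hyw⟩)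
    · exact Or.inl ⟨closedBall_subset_closedBall (by linarith) hyc, hyΩ⟩
  calc μ (thickening s Ωᶜ ∩ closedBall c (3 * r))
      ≤ 0 + μ (⋃ m : ℕ, layer Ω (1 / (m + 1 : ℝ)) s (closedBall c (3 * r))) := by
        rw [← hnull]
        exact (measure_mono hsub).trans (measure_union_le _ _)
    _ = ⨆ m : ℕ, μ (layer Ω (1 / (m + 1 : ℝ)) s (closedBall c (3 * r))) := by
        rw [zero_add, hmono.measure_iUnion]
    _ ≤ _ := iSup_le fun m => hK hr (by positivity) hs h0 hc

end Thickening

section LowerAssouad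

variable {X : Type*} [MetricSpace X] {E : Set X} {x x₀ : X} {R R₀ : ℝ}

theorem le_max_of_ediam_or_subsingleton (hE : E ⊆ closedBall x₀ R₀) (hR₀ : 0 < R₀)
    (hR : ENNReal.ofReal R < ediam E ∨ (E.Subsingleton ∧ R ≤ 1)) : R ≤ max (2 * R₀) 1 := by
  rcases hR with hR | ⟨-, hR⟩
  · have hdiam : ediam E ≤ ENNReal.ofReal (2 * R₀) := by
      rw [ENNReal.ofReal_mul two_pos.le, ENNReal.ofReal_ofNat]
      rw [← closedEBall_ofReal hR₀.le] at hE
      exact (ediam_mono hE).trans ediam_closedEBall_le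
    exact le_max_of_le_left ((ENNReal.ofReal_le_ofReal_iff (by positivity)).1 (hR.le.trans hdiam))
  · exact le_max_of_le_right hR

variable [MeasurableSpace X] {μ : Measure X} {C K : ℝ≥0}

theorem IsDoublingWith.measure_closedBall_two_mul_le (h : IsDoublingWith μ C) (hR₀ : 0 < R₀)
    (hx : x ∈ closedBall x₀ R₀) (hR : R₀ ≤ 2 * R) :
    μ (closedBall x₀ (2 * R₀)) ≤ C ^ 3 * μ (closedBall x R) :=
  calc μ (closedBall x₀ (2 * R₀)) ≤ μ (closedBall x (2 ^ 3 * (R₀ / 2))) :=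
        measure_mono (closedBall_subset_closedBall' (by linarith [mem_closedBall'.1 hx]))
    _ ≤ C ^ 3 * μ (closedBall x (R₀ / 2)) :=
        h.measure_closedBall_two_pow_mul_le x (by positivity) 3
    _ ≤ C ^ 3 * μ (closedBall x R) := by
        gcongr
        linarith

theorem IsDoublingWith.measure_thickening_inter_closedBall_le (h : IsDoublingWith μ C) {t r : ℝ}
    (hr : 0 < r) (hR : 0 < R)
    (hthick : μ (thickening r E ∩ closedBall x (3 * (R / 3))) ≤
      ENNReal.ofReal (K * (r / (R / 3)) ^ t) * μ (closedBall x (4 * (R / 3)))) :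
    μ (thickening r E ∩ closedBall x R) ≤
      ENNReal.ofReal (K * 3 ^ t * C * (r / R) ^ t) * μ (closedBall x R) := by
  have hdoub : μ (closedBall x (4 * (R / 3))) ≤ C * μ (closedBall x R) :=
    (measure_mono (closedBall_subset_closedBall (by linarith))).trans (h.doubling x R hR)
  rw [mul_div_cancel₀ R three_ne_zero] at hthick
  calc μ (thickening r E ∩ closedBall x R)
      ≤ ENNReal.ofReal (K * (r / (R / 3)) ^ t) * (C * μ (closedBall x R)) :=
        hthick.trans (by gcongr)
    _ = ENNReal.ofReal (K * 3 ^ t * C * (r / R) ^ t) * μ (closedBall x R) := by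
        rw [← mul_assoc, ← ENNReal.ofReal_coe_nnreal (p := C), ← ENNReal.ofReal_mul (by positivity),
          div_div_eq_mul_div, mul_div_right_comm, Real.mul_rpow (by positivity) three_pos.le]
        ring_nf

theorem IsDoublingWith.measure_thickening_le (h : IsDoublingWith μ C) (hR₀ : 0 < R₀)
    (hE : E ⊆ closedBall x₀ R₀) (hx : x ∈ E) {t r : ℝ} (hr : 2 * r < R₀) (hR : R₀ ≤ 2 * R)
    (hthick : μ (thickening r E ∩ closedBall x₀ (3 * (R₀ / 2))) ≤
      ENNReal.ofReal (K * (r / (R₀ / 2)) ^ t) * μ (closedBall x₀ (4 * (R₀ / 2)))) :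
    μ (thickening r E) ≤
      ENNReal.ofReal (K * C ^ 3 * (r / (R₀ / 2)) ^ t) * μ (closedBall x R) := by
  have hsub : thickening r E ⊆ closedBall x₀ (3 * (R₀ / 2)) := by
    intro y hy
    obtain ⟨w, hw, hyw⟩ := mem_thickening_iff.1 hy
    rw [mem_closedBall]
    linarith [dist_triangle y w x₀, mem_closedBall.1 (hE hw)]
  rw [inter_eq_left.2 hsub, show 4 * (R₀ / 2) = 2 * R₀ by ring] at hthick
  calc μ (thickening r E)
      ≤ ENNReal.ofReal (K * (r / (R₀ / 2)) ^ t) * (C ^ 3 * μ (closedBall x R)) :=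
        hthick.trans (by gcongr; exact h.measure_closedBall_two_mul_le hR₀ (hE hx) hR)
    _ = ENNReal.ofReal (K * C ^ 3 * (r / (R₀ / 2)) ^ t) * μ (closedBall x R) := by
        rw [← mul_assoc, ← ENNReal.ofReal_coe_nnreal (p := C), ← ENNReal.ofReal_pow (by positivity),
          mul_comm (ENNReal.ofReal _), ← ENNReal.ofReal_mul (by positivity)]
        ring_nf

theorem IsDoublingWith.measure_thickening_inter_closedBall_le_of_lt (h : IsDoublingWith μ C)
    (hR₀ : 0 < R₀) (hE : E ⊆ closedBall x₀ R₀) (hx : x ∈ E) {t r S : ℝ} (ht : 0 ≤ t) (hr : 0 < r)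
    (hR : R₀ < 2 * R) (hRS : R ≤ S)
    (hthick : μ (thickening r E ∩ closedBall x₀ (3 * (R₀ / 2))) ≤
      ENNReal.ofReal (K * (r / (R₀ / 2)) ^ t) * μ (closedBall x₀ (4 * (R₀ / 2)))) :
    μ (thickening r E ∩ closedBall x R) ≤
      ENNReal.ofReal ((1 + K * C ^ 3) * (2 * S / R₀) ^ t * (r / R) ^ t) * μ (closedBall x R) := by
  have hR0 : 0 < R := by linarith
  have hS : 0 < S := hR0.trans_le hRS
  have hscale : r / (R₀ / 2) ≤ 2 * S / R₀ * (r / R) := by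
    calc r / (R₀ / 2) = 2 * R / R₀ * (r / R) := by field_simp
      _ ≤ 2 * S / R₀ * (r / R) := by gcongr
  rw [mul_assoc (1 + _), ← Real.mul_rpow (by positivity) (by positivity)]
  rcases lt_or_ge (2 * r) R₀ with hrR₀ | hrR₀
  · refine (measure_mono inter_subset_left).trans
      ((h.measure_thickening_le hR₀ hE hx hrR₀ hR.le hthick).trans ?_)
    gcongr
    exact le_add_of_nonneg_left zero_le_one
  · have hone : 1 ≤ 2 * S / R₀ * (r / R) :=
      ((one_le_div (by positivity)).2 (by linarith)).trans hscale
    refine (measure_mono inter_subset_right).trans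
      (le_mul_of_one_le_left' (ENNReal.one_le_ofReal.2 ?_))
    exact one_le_mul_of_one_le_of_one_le (le_add_of_nonneg_right (by positivity))
      (Real.one_le_rpow hone ht)

theorem IsDoublingWith.ofReal_le_lcodimA (h : IsDoublingWith μ C) (hR₀ : 0 < R₀)
    (hE : E ⊆ closedBall x₀ R₀) {t : ℝ} (ht : 0 ≤ t)
    (hthick : ∀ {c : X} {r s : ℝ}, 0 < r → 0 < s → closedBall c (4 * r) ⊆ closedBall x₀ (2 * R₀) →
      (closedBall c (4 * r) ∩ E).Nonempty → μ (thickening s E ∩ closedBall c (3 * r)) ≤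
        ENNReal.ofReal (K * (s / r) ^ t) * μ (closedBall c (4 * r))) :
    ENNReal.ofReal t ≤ lcodimA μ E := by
  set P : ℝ := K * 3 ^ t * C
  set Q : ℝ := (1 + K * C ^ 3) * (2 * max (2 * R₀) 1 / R₀) ^ t
  have hP : 0 ≤ P := by positivity
  have hQ : 0 ≤ Q := by positivity
  refine le_iSup₂_of_le t.toNNReal ⟨1 + P + Q, by linarith, fun x hx r R hr hrR hR => ?_⟩ le_rfl
  have hR0 : 0 < R := hr.trans hrR
  have hxx₀ := mem_closedBall.1 (hE hx)
  rw [Real.coe_toNNReal t ht]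
  refine ENNReal.div_le_of_le_mul ?_
  rcases le_or_gt (2 * R) R₀ with hRR₀ | hRR₀
  · refine (h.measure_thickening_inter_closedBall_le hr hR0 <| hthick (by positivity) hr
      (closedBall_subset_closedBall' (by linarith))
      ⟨x, mem_closedBall_self (by positivity), hx⟩).trans ?_
    gcongr
    linarith
  · refine (h.measure_thickening_inter_closedBall_le_of_lt hR₀ hE hx ht hr hRR₀
      (le_max_of_ediam_or_subsingleton hE hR₀ hR) <| hthick (by positivity) hr
      (closedBall_subset_closedBall (by linarith))
      ⟨x, mem_closedBall.2 (by linarith), hx⟩).trans ?_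
    gcongr
    linarith

end LowerAssouad

theorem AdmitsHardyWith.ofReal_le_lcodimA {X : Type*} [MetricSpace X] [CompleteSpace X]
    [MeasurableSpace X] [BorelSpace X] {μ : Measure X} {Ω : Set X} {p β δ : ℝ} {C C_D : ℝ≥0}
    (hHardy : AdmitsHardyWith μ Ω p β C) (h : IsDoublingWith μ C_D) (hp : 0 < p) (hΩ : IsOpen Ω)
    (hδ : 0 < δ) (hC : C * (2 ^ p * δ ^ p) < 2⁻¹) (hq : 0 ≤ p - β - δ * p) {x₀ : X} {R₀ : ℝ}
    (hR₀ : 0 < R₀)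
    (hcod : ENNReal.ofReal (p - β - δ * p) < codimH μ (closedBall x₀ (2 * R₀) ∩ Ωᶜ)) :
    ENNReal.ofReal (p - β + δ * p) ≤ lcodimA μ (closedBall x₀ R₀ ∩ Ωᶜ) := by
  have hδp : 0 < δ * p := by positivity
  obtain ⟨K, hK⟩ := hHardy.exists_measure_thickening_le h hp hΩ hδ hC hq
  refine h.ofReal_le_lcodimA (K := K) hR₀ inter_subset_left (by linarith)
    fun {c r s} hr hs hsub hc => ?_
  calc μ (thickening s (closedBall x₀ R₀ ∩ Ωᶜ) ∩ closedBall c (3 * r))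
      ≤ μ (thickening s Ωᶜ ∩ closedBall c (3 * r)) := measure_mono <|
        inter_subset_inter_left _ (thickening_subset_of_subset _ inter_subset_right)
    _ ≤ _ := hK hr hs (fun R hR => hausdorffCocontent_eq_zero_of_lt_codimH hcod
        (inter_subset_inter_left _ hsub) hR)
        (hc.mono (inter_subset_inter_right _ inter_subset_right))

theorem exists_pos_mul_le_and_mul_rpow_lt {p M : ℝ} (hp : 0 < p) (hM : 0 < M) (C : ℝ≥0) :
    ∃ δ : ℝ, 0 < δ ∧ δ * p ≤ M ∧ C * (2 ^ p * δ ^ p) < 2⁻¹ := by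
  have hcont : Continuous fun δ : ℝ => δ ^ p := Real.continuous_rpow_const hp.le
  have hlim : Tendsto (fun δ : ℝ => C * (2 ^ p * δ ^ p)) (𝓝 0) (𝓝 0) :=
    Continuous.tendsto' (by fun_prop) _ _ (by rw [Real.zero_rpow hp.ne', mul_zero, mul_zero])
  have hsmall : ∀ᶠ δ : ℝ in 𝓝[>] 0, C * (2 ^ p * δ ^ p) < 2⁻¹ :=
    (hlim.eventually_lt_const (by positivity)).filter_mono nhdsWithin_le_nhds
  obtain ⟨δ, hδC, hδ, hδM⟩ := (hsmall.and (Ioc_mem_nhdsGT (div_pos hM hp))).exists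
  exact ⟨δ, hδ, (le_div_iff₀ hp).1 hδM, hδC⟩

theorem ofReal_lt_of_coe_le_coe {s t : ℝ} {b : ℝ≥0∞} (hs : 0 ≤ s) (hst : s < t)
    (h : (t : EReal) ≤ b) : ENNReal.ofReal s < b := by
  rw [← EReal.coe_ennreal_lt_coe_ennreal_iff, EReal.coe_ennreal_ofReal, max_eq_left hs]
  exact (EReal.coe_lt_coe_iff.2 hst).trans_le h

theorem coe_lt_coe_of_ofReal_le {s t : ℝ} {b : ℝ≥0∞} (hst : s < t)
    (h : ENNReal.ofReal t ≤ b) : (s : EReal) < b := by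
  rw [← EReal.coe_ennreal_le_coe_ennreal_iff, EReal.coe_ennreal_ofReal] at h
  exact (EReal.coe_lt_coe_iff.2 hst).trans_le ((EReal.coe_le_coe_iff.2 (le_max_left t 0)).trans h)

theorem theorem6p2_general (p β : ℝ) (hp : 0 < p) (hβ : β ≠ p) (C_H : ℝ≥0) :
    ∃ ε : ℝ, 0 < ε ∧
      ∀ (X : Type*) [MetricSpace X] [CompleteSpace X] [MeasurableSpace X] [BorelSpace X]
        (μ : Measure X) (C_D : ℝ≥0), IsDoublingWith μ C_D →
      ∀ Ω : Set X, IsOpen Ω → AdmitsHardyWith μ Ω p β C_H →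
      ∀ (x₀ : X) (R₀ : ℝ), 0 < R₀ →
        ((codimH μ (closedBall x₀ (2 * R₀) ∩ Ωᶜ) : EReal) < ((p - β - ε : ℝ) : EReal) ∨
          ((p - β + ε : ℝ) : EReal) < (lcodimA μ (closedBall x₀ R₀ ∩ Ωᶜ) : EReal)) := by
  rcases lt_or_gt_of_ne hβ with hlt | hgt
  · obtain ⟨δ, hδ, hδp, hδC⟩ := exists_pos_mul_le_and_mul_rpow_lt hp (sub_pos.2 hlt) C_H
    have hε : 0 < δ * p := by positivity
    refine ⟨δ * p / 2, by positivity, fun X _ _ _ _ μ C_D h Ω hΩ hHardy x₀ R₀ hR₀ =>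
      or_iff_not_imp_left.2 fun hcod => ?_⟩
    have hlcodim := hHardy.ofReal_le_lcodimA h hp hΩ hδ hδC (by linarith) hR₀ <|
      ofReal_lt_of_coe_le_coe (by linarith) (by linarith) (not_lt.1 hcod)
    exact coe_lt_coe_of_ofReal_le (by linarith) hlcodim
  · exact ⟨(β - p) / 2, by linarith, fun X _ _ _ _ μ C_D _ Ω _ _ x₀ R₀ _ =>
      Or.inr (lt_of_lt_of_le (EReal.coe_neg'.2 (by linarith)) (EReal.coe_ennreal_nonneg _))⟩

theorem theorem6p2 (p β : ℝ) (hp : 1 ≤ p) (hβ : β ≠ p) (C_D C_H : ℝ≥0) :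
    ∃ ε : ℝ, 0 < ε ∧
      ∀ (X : Type*) [MetricSpace X] [CompleteSpace X] [MeasurableSpace X] [BorelSpace X]
        (μ : Measure X), IsDoublingWith μ C_D →
      ∀ Ω : Set X, IsOpen Ω → AdmitsHardyWith μ Ω p β C_H →
      ∀ (x₀ : X) (R₀ : ℝ), 0 < R₀ →
        ((codimH μ (closedBall x₀ (2 * R₀) ∩ Ωᶜ) : EReal) < ((p - β - ε : ℝ) : EReal) ∨
          ((p - β + ε : ℝ) : EReal) < (lcodimA μ (closedBall x₀ R₀ ∩ Ωᶜ) : EReal)) := by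
  obtain ⟨ε, hε, h⟩ := theorem6p2_general p β (zero_lt_one.trans_le hp) hβ C_H
  exact ⟨ε, hε, fun X _ _ _ _ μ => h X μ C_D⟩
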